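/- **Notation.** For a real matrix $M$, $\|M\|$ is the spectral norm, $\|M\|_*$ the nuclear norm, $[M]_i$ the $i$-th column, $\|M\|_{2,1}=\sum_i\|[M]_i\|_2$ and $\|M\|_{2,\infty}=\max_i\|[M]_i\|_2$. All SVDs are thin: $M=U\Sigma V^T$ with $U^TU=\mathtt I$, $V^TV=\mathtt I$ and $\Sigma$ diagonal with positive diagonal entries. For a set $\mathcal I$ of column indices, $\mathcal P_{\mathcal I}(M)$ is $M$ with the columns outside $\mathcal I$ set to zero. For matrices $U,V$ with orthonormal columns, $\mathcal P_U(M)=UU^TM$, $\mathcal P_V(M)=MVV^T$, $\mathcal P^L_V(M)=VV^TM$ and $\mathcal P^L_{V^\perp}(M)=M-\mathcal P_V^L(M)$. **Setting.** Let $X=X_0+C_0\in\mathbb R^{d\times n}$, where $X_0\neq0$ has rank $r_0$ and SVD $U_0\Sigma_0V_0^T$. Let $\mathcal I_0$ be the set of indices of the non-zero columns of $C_0$, let $\gamma=|\mathcal I_0|/n$, and assume $\mathcal P_{\mathcal I_0}(X_0)=0$. Let $X=U_X\Sigma_XV_X^T$ be an SVD, and assume $\mathcal P_{V_X}^L(V_0)=V_0$.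 Let $\beta>0$ and $\mu$ be such that $$\|\Sigma_X^{-1}V_X^TV_0\|\le\frac1{\beta\|X\|},\qquad \max_i\|V_0^T\mathbf e_i\|_2^2\le\frac{\mu r_0}{(1-\gamma)n}.$$ Let $\lambda>0$, and let $(\hat Z,\hat C)$ be an optimal solution of the oracle problem $$\min_{Z,C}\ \|Z\|_*+\lambda\|C\|_{2,1}\quad\text{s.t.}\quad X=XZ+C,\ \ \mathcal P_{V_0}^L(Z)=Z,\ \ \mathcal P_{\mathcal I_0}(C)=C.$$ Let $\hat Z=\hat U\hat\Sigma\hat V^T$ be an SVD and put $\bar V=\hat V\hat U^TV_0$. Let $\hat H$ be the matrix with $[\hat H]_i=[\hat C]_i/\|[\hat C]_i\|_2$ for $i\in\mathcal I_0$ and $[\hat H]_i=0$ for $i\notin\mathcal I_0$. Put $G=\mathcal P_{\mathcal I_0}(\bar V^T)(\mathcal P_{\mathcal I_0}(\bar V^T))^T$, $\psi=\|G\|$, and $$Q_1=\lambda\mathcal P_{V_0}^L(X^T\hat H),\qquad Q_2=\lambda\mathcal P_{V_0^\perp}^L\mathcal P_{\mathcal I_0^c}\mathcal P_{\bar V}\Big(\mathtt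 I+\sum_{i=1}^\infty(\mathcal P_{\bar V}\mathcal P_{\mathcal I_0}\mathcal P_{\bar V})^i\Big)\mathcal P_{\bar V}(X^T\hat H),$$ $$Q=U_X\Sigma_X^{-1}V_X^T\big(V_0\bar V^T+\lambda X^T\hat H-Q_1-Q_2\big).$$ **Theorem.** Assume $\psi<1$, $$\frac{\gamma}{1-\gamma}<\frac{\beta^2(1-\psi)^2}{(3-\psi+\beta)^2\mu r_0},$$ and $$\frac{(1-\psi)\sqrt{\frac{\mu r_0}{1-\gamma}}}{\|X\|\sqrt n\Big(\beta(1-\psi)-(1+\beta)\sqrt{\frac{\gamma}{1-\gamma}\mu r_0}\Big)}<\lambda<\frac{1-\psi}{\|X\|\sqrt{\gamma n}\,(2-\psi)},$$ where the upper bound on $\lambda$ is read as $+\infty$ if $\gamma=0$. Then the series defining $Q_2$ converges, and $\mathtt I+\sum_{i\ge1}(\mathcal P_{\bar V}\mathcal P_{\mathcal I_0}\mathcal P_{\bar V})^i$ is the inverse of $\mathcal P_{\bar V}\mathcal P_{\mathcal I_0^c}\mathcal P_{\bar V}$ on the space $\{M\in\mathbb R^{n\times n}:\mathcal P_{\bar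 V}(M)=M\}$. Moreover, with $\mathcal P_{\hat T}=\mathcal P_{\hat U}+\mathcal P_{\hat V}-\mathcal P_{\hat U}\mathcal P_{\hat V}$, the matrix $Q$ satisfies the dual conditions - (a) $\mathcal P_{\hat T}(X^TQ)=\hat U\hat V^T$, - (b) $\|X^TQ-\mathcal P_{\hat T}(X^TQ)\|<1$, - (c) $\mathcal P_{\mathcal I_0}(Q)=\lambda\hat H$, - (d) $\|\mathcal P_{\mathcal I_0^c}(Q)\|_{2,\infty}<\lambda$, and the only $M\in\mathbb R^{n\times n}$ with $\mathcal P_{\mathcal I_0}(M)=M$ and $\mathcal P_{\hat V}(M)=M$ is $M=0$. -/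

import Mathlib

open scoped Matrix Matrix.Norms.L2Operator

noncomputable section

namespace LRR

/-! In this development `‖M‖` is the spectral norm (largest singular value) of a real matrix `M`. -/

/-- `U * diagonal σ * Vᵀ` is a (thin) singular value decomposition of `M`: the columns of `U` and
of `V` are orthonormal and the `r` diagonal entries `σ` are positive, so that `r = rank M`. -/
structure IsSVD {p q r : ℕ} (M : Matrix (Fin p) (Fin q) ℝ) (U : Matrix (Fin p) (Fin r) ℝ)
    (σ : Fin r → ℝ) (V : Matrix (Fin q) (Fin r) ℝ) : Prop where
  eq : M = U * Matrix.diagonal σ * Vᵀ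
  orthU : Uᵀ * U = 1
  orthV : Vᵀ * V = 1
  pos : ∀ i, 0 < σ i

/-- The `ℓ₂` norm of the `j`-th column of `M`. -/
def colNorm {p q : ℕ} (M : Matrix (Fin p) (Fin q) ℝ) (j : Fin q) : ℝ :=
  ‖WithLp.toLp 2 (fun i => M i j)‖

/-- The `ℓ_{2,1}` norm: the sum of the `ℓ₂` norms of the columns. -/
def norm21 {p q : ℕ} (M : Matrix (Fin p) (Fin q) ℝ) : ℝ := ∑ j, colNorm M j

/-- The `ℓ_{2,∞}` norm: the largest `ℓ₂` norm of a column. -/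
def norm2Inf {p q : ℕ} (M : Matrix (Fin p) (Fin q) ℝ) : ℝ := ⨆ j, colNorm M j

/-- The nuclear norm: the sum of the singular values. -/
def nuclearNorm {p q : ℕ} (M : Matrix (Fin p) (Fin q) ℝ) : ℝ :=
  ∑ i : Fin q, (Matrix.toEuclideanLin M).singularValues i

/-- The column support of `M`: the indices of its non-zero columns. -/
def colSupport {p q : ℕ} (M : Matrix (Fin p) (Fin q) ℝ) : Finset (Fin q) :=
  open Classical in Finset.univ.filter fun j => ∃ i, M i j ≠ 0

/-- `P_I(M)`: the columns of `M` with index outside `I` are set to zero. -/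
def projCols {p q : ℕ} (I : Finset (Fin q)) (M : Matrix (Fin p) (Fin q) ℝ) :
    Matrix (Fin p) (Fin q) ℝ :=
  Matrix.of fun i j => if j ∈ I then M i j else 0

/-- `P_U(M) = U Uᵀ M`; this is also `P_U^L` when `U` holds a row space. -/
def projL {p q r : ℕ} (U : Matrix (Fin p) (Fin r) ℝ) (M : Matrix (Fin p) (Fin q) ℝ) :
    Matrix (Fin p) (Fin q) ℝ :=
  U * Uᵀ * M

/-- `P_V(M) = M V Vᵀ`. -/
def projR {p q r : ℕ} (V : Matrix (Fin q) (Fin r) ℝ) (M : Matrix (Fin p) (Fin q) ℝ) :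
    Matrix (Fin p) (Fin q) ℝ :=
  M * (V * Vᵀ)

/-- `P_T(M) = P_U(M) + P_V(M) - P_U P_V(M)`. -/
def projT {p q r s : ℕ} (U : Matrix (Fin p) (Fin r) ℝ) (V : Matrix (Fin q) (Fin s) ℝ)
    (M : Matrix (Fin p) (Fin q) ℝ) : Matrix (Fin p) (Fin q) ℝ :=
  projL U M + projR V M - projL U (projR V M)

/-- `B(C)`: the columns of `C` with index in `I` are normalized, the others are zero. -/
def colNormalize {p q : ℕ} (I : Finset (Fin q)) (C : Matrix (Fin p) (Fin q) ℝ) :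
    Matrix (Fin p) (Fin q) ℝ :=
  Matrix.of fun i j => if j ∈ I then C i j / colNorm C j else 0

/-- `X` (with SVD `U_X diag(σX) V_Xᵀ`) is relatively well-defined with parameter `β` with regard to
a matrix whose right singular vectors are the columns of `V₀`. -/
def IsRWD {d n r rX : ℕ} (X : Matrix (Fin d) (Fin n) ℝ) (σX : Fin rX → ℝ)
    (VX : Matrix (Fin n) (Fin rX) ℝ) (V₀ : Matrix (Fin n) (Fin r) ℝ) (β : ℝ) : Prop :=
  ‖Matrix.diagonal σX⁻¹ * VXᵀ * V₀‖ ≤ 1 / (β * ‖X‖)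

/-- Column-incoherence with parameter `μ`, with outlier fraction `γ`:
`max_i ‖V₀ᵀ e_i‖² ≤ μ r / ((1 - γ) n)`. -/
def IsColIncoherent {n r : ℕ} (V₀ : Matrix (Fin n) (Fin r) ℝ) (γ μ : ℝ) : Prop :=
  ∀ i, colNorm V₀ᵀ i ^ 2 ≤ μ * r / ((1 - γ) * n)

/-- Feasibility for the oracle problem. -/
structure OracleFeasible {d n r : ℕ} (X : Matrix (Fin d) (Fin n) ℝ)
    (V₀ : Matrix (Fin n) (Fin r) ℝ) (I₀ : Finset (Fin n))
    (Z : Matrix (Fin n) (Fin n) ℝ) (C : Matrix (Fin d) (Fin n) ℝ) : Prop where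
  data : X = X * Z + C
  row : projL V₀ Z = Z
  supp : projCols I₀ C = C

/-- `(Z, C)` is an optimal solution of the oracle problem: minimize `‖Z‖_* + lam ‖C‖_{2,1}` subject
to `X = X Z + C`, `P_{V₀}^L(Z) = Z`, `P_{I₀}(C) = C`. -/
structure IsOracleSolution {d n r : ℕ} (X : Matrix (Fin d) (Fin n) ℝ)
    (V₀ : Matrix (Fin n) (Fin r) ℝ) (I₀ : Finset (Fin n)) (lam : ℝ)
    (Z : Matrix (Fin n) (Fin n) ℝ) (C : Matrix (Fin d) (Fin n) ℝ) : Prop where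
  feasible : OracleFeasible X V₀ I₀ Z C
  optimal : ∀ Z' C', OracleFeasible X V₀ I₀ Z' C' →
    nuclearNorm Z + lam * norm21 C ≤ nuclearNorm Z' + lam * norm21 C'

/-- `V̄ = V̂ Ûᵀ V₀`. -/
def Vbar {n r s : ℕ} (U V : Matrix (Fin n) (Fin s) ℝ) (V₀ : Matrix (Fin n) (Fin r) ℝ) :
    Matrix (Fin n) (Fin r) ℝ :=
  V * Uᵀ * V₀

/-- `G = P_{I₀}(V̄ᵀ) (P_{I₀}(V̄ᵀ))ᵀ`. -/
def gram {n r : ℕ} (I₀ : Finset (Fin n)) (Vb : Matrix (Fin n) (Fin r) ℝ) :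
    Matrix (Fin r) (Fin r) ℝ :=
  projCols I₀ Vbᵀ * (projCols I₀ Vbᵀ)ᵀ

/-- The operator `P_V̄ P_I P_V̄`. -/
def sandwich {p n r : ℕ} (I : Finset (Fin n)) (Vb : Matrix (Fin n) (Fin r) ℝ)
    (M : Matrix (Fin p) (Fin n) ℝ) : Matrix (Fin p) (Fin n) ℝ :=
  projR Vb (projCols I (projR Vb M))

/-- The operator `1 + ∑_{i ≥ 1} (P_V̄ P_I P_V̄)^i`. -/
def neumann {p n r : ℕ} (I : Finset (Fin n)) (Vb : Matrix (Fin n) (Fin r) ℝ)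
    (M : Matrix (Fin p) (Fin n) ℝ) : Matrix (Fin p) (Fin n) ℝ :=
  M + ∑' i : ℕ, (sandwich I Vb)^[i + 1] M

/-- `Q₁ = lam P_{V₀}^L(Xᵀ H)`. -/
def certQ₁ {d n r : ℕ} (X : Matrix (Fin d) (Fin n) ℝ) (V₀ : Matrix (Fin n) (Fin r) ℝ) (lam : ℝ)
    (H : Matrix (Fin d) (Fin n) ℝ) : Matrix (Fin n) (Fin n) ℝ :=
  lam • projL V₀ (Xᵀ * H)

/-- `Q₂ = lam P_{V₀^⊥}^L P_{I₀ᶜ} P_V̄ (1 + ∑_{i ≥ 1} (P_V̄ P_{I₀} P_V̄)^i) P_V̄ (Xᵀ H)`, where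
`P_{V₀^⊥}^L(M) = M - P_{V₀}^L(M)`. -/
def certQ₂ {d n r : ℕ} (X : Matrix (Fin d) (Fin n) ℝ) (V₀ : Matrix (Fin n) (Fin r) ℝ)
    (I₀ : Finset (Fin n)) (Vb : Matrix (Fin n) (Fin r) ℝ) (lam : ℝ)
    (H : Matrix (Fin d) (Fin n) ℝ) : Matrix (Fin n) (Fin n) ℝ :=
  let N := projCols I₀ᶜ (projR Vb (neumann I₀ Vb (projR Vb (Xᵀ * H))))
  lam • (N - projL V₀ N)

/-- `Q = U_X Σ_X⁻¹ V_Xᵀ (V₀ V̄ᵀ + lam Xᵀ H - Q₁ - Q₂)`. -/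
def certQ {d n r rX : ℕ} (X : Matrix (Fin d) (Fin n) ℝ) (UX : Matrix (Fin d) (Fin rX) ℝ)
    (σX : Fin rX → ℝ) (VX : Matrix (Fin n) (Fin rX) ℝ) (V₀ : Matrix (Fin n) (Fin r) ℝ)
    (I₀ : Finset (Fin n)) (Vb : Matrix (Fin n) (Fin r) ℝ) (lam : ℝ)
    (H : Matrix (Fin d) (Fin n) ℝ) : Matrix (Fin d) (Fin n) ℝ :=
  UX * Matrix.diagonal σX⁻¹ * VXᵀ *
    (V₀ * Vbᵀ + lam • (Xᵀ * H) - certQ₁ X V₀ lam H - certQ₂ X V₀ I₀ Vb lam H)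

/-- The dual conditions for a pair whose first member has the singular vectors `U`, `V` and whose
second member is `C`. -/
structure DualConditions {d n s : ℕ} (X : Matrix (Fin d) (Fin n) ℝ) (I₀ : Finset (Fin n))
    (lam : ℝ) (U V : Matrix (Fin n) (Fin s) ℝ) (C Q : Matrix (Fin d) (Fin n) ℝ) : Prop where
  a : projT U V (Xᵀ * Q) = U * Vᵀ
  b : ‖Xᵀ * Q - projT U V (Xᵀ * Q)‖ < 1
  c : projCols I₀ Q = lam • colNormalize I₀ C
  d : norm2Inf (projCols I₀ᶜ Q) < lam

end LRR

end

/-! Write `D` for the diagonal mask of `I₀`, `Dᶜ` for its complement and `W` for `V̄`. Three facts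
about the oracle solution carry the proof.

Geometry: on the clean columns the constraint reads `X₀ = X₀ V₀ (V₀ᵀ Ẑ Dᶜ)`, and cancelling `U₀ Σ₀`
gives `V₀ᵀ Ẑ Dᶜ = V₀ᵀ` (`right_transpose_mul_solution`). Hence `Û Ûᵀ = V₀ V₀ᵀ`, so that `W` has
orthonormal columns, `V₀ Wᵀ = Û V̂ᵀ` and `W Wᵀ = V̂ V̂ᵀ`. Moreover the singular values of `Ẑ` are at
least 1, so `W` inherits the incoherence of `V₀` off `I₀` (`colNorm_Vbar_le`).

Support: no column of `Ĉ` in `I₀` vanishes (`colNorm_solution_pos`), so the `ℓ_{2,1}` term is smooth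
along feasible directions supported on `I₀`.

Stationarity: varying `Ẑ` along `V₀ Δ` with `Δ` supported on `I₀` yields `Wᵀ D = λ V₀ᵀ Xᵀ Ĥ`. No
subdifferential is needed, since both terms of the objective have quadratic upper bounds in the step
length.

The column operators in the certificate are right multiplications. With `P = W Wᵀ`, the matrix `S =
P D P` has norm at most `ψ < 1`, so `R = (1 - S)⁻¹` is the Neumann sum. Put `K = P R P Dᶜ`. Then `Xᵀ
Q = V₀ Wᵀ + λ (1 - V₀ V₀ᵀ) Xᵀ Ĥ (1 - K)`. The identity `K P = P` gives (a), while `K D = 0` and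
stationarity give (c). Conditions (b) and (d) follow from `‖K‖ ≤ 1 / (1 - ψ)`, its columnwise
analogue, and `‖Ĥ‖ ≤ √(γ n)`. The bound on `γ` makes the denominator in the lower bound on `λ`
positive. -/

noncomputable section

namespace LRR

/-! ### Spectral norm, column norms and the trace pairing. -/

section Norms

variable {p q r s : ℕ}

theorem l2_opNorm_transpose (A : Matrix (Fin p) (Fin q) ℝ) : ‖Aᵀ‖ = ‖A‖ := by
  rw [← Matrix.conjTranspose_eq_transpose_of_trivial, Matrix.l2_opNorm_conjTranspose]

theorem l2_opNorm_transpose_mul_self (A : Matrix (Fin p) (Fin q) ℝ) : ‖Aᵀ * A‖ = ‖A‖ ^ 2 := by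
  rw [← Matrix.conjTranspose_eq_transpose_of_trivial, Matrix.l2_opNorm_conjTranspose_mul_self, sq]

theorem l2_opNorm_diagonal_le {v : Fin q → ℝ} {c : ℝ} (hc : 0 ≤ c) (hv : ∀ i, |v i| ≤ c) :
    ‖Matrix.diagonal v‖ ≤ c := by
  rw [Matrix.l2_opNorm_diagonal, pi_norm_le_iff_of_nonneg hc]
  exact hv

theorem l2_opNorm_one_le : ‖(1 : Matrix (Fin q) (Fin q) ℝ)‖ ≤ 1 := by
  rw [← Matrix.diagonal_one]
  exact l2_opNorm_diagonal_le zero_le_one fun i => by simp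

theorem l2_opNorm_le_one_of_transpose_mul_self {A : Matrix (Fin p) (Fin q) ℝ}
    (h : ‖Aᵀ * A‖ ≤ 1) : ‖A‖ ≤ 1 := by
  rw [l2_opNorm_transpose_mul_self] at h
  nlinarith [norm_nonneg A]

theorem l2_opNorm_le_one_of_orth {A : Matrix (Fin p) (Fin q) ℝ} (h : Aᵀ * A = 1) : ‖A‖ ≤ 1 :=
  l2_opNorm_le_one_of_transpose_mul_self (h ▸ l2_opNorm_one_le)

theorem l2_opNorm_mul_le_of_le_one_left {A : Matrix (Fin p) (Fin q) ℝ} (hA : ‖A‖ ≤ 1)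
    (B : Matrix (Fin q) (Fin r) ℝ) : ‖A * B‖ ≤ ‖B‖ :=
  (Matrix.l2_opNorm_mul A B).trans (mul_le_of_le_one_left (norm_nonneg _) hA)

theorem l2_opNorm_mul_le_of_le_one_right {B : Matrix (Fin q) (Fin r) ℝ} (hB : ‖B‖ ≤ 1)
    (A : Matrix (Fin p) (Fin q) ℝ) : ‖A * B‖ ≤ ‖A‖ :=
  (Matrix.l2_opNorm_mul A B).trans (mul_le_of_le_one_right (norm_nonneg _) hB)

theorem colNorm_nonneg (M : Matrix (Fin p) (Fin q) ℝ) (j : Fin q) : 0 ≤ colNorm M j :=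
  norm_nonneg _

theorem colNorm_sq (M : Matrix (Fin p) (Fin q) ℝ) (j : Fin q) :
    colNorm M j ^ 2 = ∑ i, M i j ^ 2 := by
  simp [colNorm, EuclideanSpace.norm_sq_eq]

theorem colNorm_eq_sqrt (M : Matrix (Fin p) (Fin q) ℝ) (j : Fin q) :
    colNorm M j = √(∑ i, M i j ^ 2) := by
  rw [← colNorm_sq, Real.sqrt_sq (colNorm_nonneg M j)]

theorem colNorm_eq_zero {M : Matrix (Fin p) (Fin q) ℝ} {j : Fin q} :
    colNorm M j = 0 ↔ ∀ i, M i j = 0 := by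
  rw [← sq_eq_zero_iff, colNorm_sq, Finset.sum_eq_zero_iff_of_nonneg fun i _ => sq_nonneg _]
  simp

theorem colNorm_congr {M N : Matrix (Fin p) (Fin q) ℝ} {j : Fin q} (h : ∀ i, M i j = N i j) :
    colNorm M j = colNorm N j := by
  simp only [colNorm, h]

theorem colNorm_sub_le (M N : Matrix (Fin p) (Fin q) ℝ) (j : Fin q) :
    colNorm (M - N) j ≤ colNorm M j + colNorm N j :=
  norm_sub_le (WithLp.toLp 2 fun i => M i j) (WithLp.toLp 2 fun i => N i j)

theorem colNorm_smul (c : ℝ) (M : Matrix (Fin p) (Fin q) ℝ) (j : Fin q) :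
    colNorm (c • M) j = |c| * colNorm M j :=
  norm_smul c (WithLp.toLp 2 fun i => M i j)

theorem colNorm_mul_le (A : Matrix (Fin p) (Fin q) ℝ) (B : Matrix (Fin q) (Fin r) ℝ) (j : Fin r) :
    colNorm (A * B) j ≤ ‖A‖ * colNorm B j :=
  Matrix.l2_opNorm_mulVec A (WithLp.toLp 2 fun i => B i j)

theorem colNorm_mul_le_of_le_one {A : Matrix (Fin p) (Fin q) ℝ} (hA : ‖A‖ ≤ 1)
    (B : Matrix (Fin q) (Fin r) ℝ) (j : Fin r) : colNorm (A * B) j ≤ colNorm B j :=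
  (colNorm_mul_le A B j).trans (mul_le_of_le_one_left (colNorm_nonneg _ _) hA)

theorem colNorm_orth_mul {A : Matrix (Fin p) (Fin q) ℝ} (h : Aᵀ * A = 1)
    (B : Matrix (Fin q) (Fin r) ℝ) (j : Fin r) : colNorm (A * B) j = colNorm B j := by
  refine (colNorm_mul_le_of_le_one (l2_opNorm_le_one_of_orth h) B j).antisymm ?_
  have := colNorm_mul_le_of_le_one (A := Aᵀ)
    ((l2_opNorm_transpose A).trans_le (l2_opNorm_le_one_of_orth h)) (A * B) j
  rwa [← Matrix.mul_assoc, h, Matrix.one_mul] at this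

theorem sum_mul_le_colNorm_mul_colNorm (A B : Matrix (Fin p) (Fin q) ℝ) (j : Fin q) :
    ∑ i, A i j * B i j ≤ colNorm A j * colNorm B j := by
  rw [colNorm_eq_sqrt, colNorm_eq_sqrt]
  exact Real.sum_mul_le_sqrt_mul_sqrt _ _ _

theorem trace_transpose_mul (A B : Matrix (Fin p) (Fin q) ℝ) :
    (Aᵀ * B).trace = ∑ j, ∑ i, A i j * B i j := by
  simp [Matrix.trace, Matrix.mul_apply]

theorem trace_transpose_mul_self (A : Matrix (Fin p) (Fin q) ℝ) :
    (Aᵀ * A).trace = ∑ j, colNorm A j ^ 2 := by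
  rw [trace_transpose_mul]
  simp only [colNorm_sq]
  simp only [sq]

theorem trace_transpose_mul_le (A B : Matrix (Fin p) (Fin q) ℝ) :
    (Aᵀ * B).trace ≤ ∑ j, colNorm A j * colNorm B j := by
  rw [trace_transpose_mul]
  exact Finset.sum_le_sum fun j _ => sum_mul_le_colNorm_mul_colNorm A B j

theorem trace_transpose_mul_comm (A B : Matrix (Fin p) (Fin q) ℝ) :
    (Aᵀ * B).trace = (Bᵀ * A).trace := by
  simp [trace_transpose_mul, mul_comm]

theorem two_mul_trace_transpose_mul_le (A B : Matrix (Fin p) (Fin q) ℝ) :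
    2 * (Aᵀ * B).trace ≤ (Aᵀ * A).trace + (Bᵀ * B).trace := by
  rw [trace_transpose_mul, trace_transpose_mul, trace_transpose_mul, ← Finset.sum_add_distrib,
    Finset.mul_sum]
  refine Finset.sum_le_sum fun j _ => ?_
  rw [Finset.mul_sum, ← Finset.sum_add_distrib]
  exact Finset.sum_le_sum fun i _ => by nlinarith [sq_nonneg (A i j - B i j)]

theorem l2_opNorm_le_sqrt_sum (A : Matrix (Fin p) (Fin q) ℝ) :
    ‖A‖ ≤ √(∑ j, colNorm A j ^ 2) := by
  rw [Matrix.l2_opNorm_def]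
  refine ContinuousLinearMap.opNorm_le_bound _ (Real.sqrt_nonneg _) fun x => ?_
  refine le_of_sq_le_sq ?_ (by positivity)
  rw [mul_pow, Real.sq_sqrt (Finset.sum_nonneg fun j _ => sq_nonneg _), EuclideanSpace.norm_sq_eq,
    EuclideanSpace.norm_sq_eq]
  simp only [colNorm_sq]
  rw [Finset.sum_comm, Finset.sum_mul]
  refine Finset.sum_le_sum fun i _ => ?_
  simpa [Matrix.toLpLin_apply, Matrix.mulVec, dotProduct] using
    Finset.sum_mul_sq_le_sq_mul_sq Finset.univ (fun j => A i j) (fun j => x j)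

end Norms

/-! ### The nuclear norm: a duality bound and a factorization bound. -/

section NuclearNorm

variable {p q r s : ℕ}

theorem exists_orthonormalBasis_inner_map_map {E F : Type*} [NormedAddCommGroup E]
    [InnerProductSpace ℝ E] [FiniteDimensional ℝ E] [NormedAddCommGroup F] [InnerProductSpace ℝ F]
    [FiniteDimensional ℝ F] (T : E →ₗ[ℝ] F) {n : ℕ} (hn : Module.finrank ℝ E = n) :
    ∃ b : OrthonormalBasis (Fin n) ℝ E, ∀ i j,
      inner ℝ (T (b i)) (T (b j)) = if i = j then T.singularValues i ^ 2 else 0 := by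
  refine ⟨T.isSymmetric_adjoint_comp_self.eigenvectorBasis hn, fun i j => ?_⟩
  rw [← LinearMap.adjoint_inner_right, ← LinearMap.comp_apply,
    T.isSymmetric_adjoint_comp_self.apply_eigenvectorBasis, inner_smul_right,
    orthonormal_iff_ite.1 (T.isSymmetric_adjoint_comp_self.eigenvectorBasis hn).orthonormal i j,
    T.sq_singularValues_fin hn]
  split_ifs with h
  · subst h; simp
  · simp

/-- The columns of `W` are eigenvectors of `Mᵀ M`. This is the half of the SVD that involves no left
singular vectors, which need a choice when some `s i` vanish. -/
theorem exists_orthogonal_gram_diagonal (M : Matrix (Fin p) (Fin q) ℝ) :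
    ∃ (W : Matrix (Fin q) (Fin q) ℝ) (s : Fin q → ℝ), Wᵀ * W = 1 ∧ W * Wᵀ = 1 ∧ (∀ i, 0 ≤ s i) ∧
      (M * W)ᵀ * (M * W) = Matrix.diagonal (fun i => s i ^ 2) ∧ nuclearNorm M = ∑ i, s i := by
  obtain ⟨b, hb⟩ := exists_orthonormalBasis_inner_map_map (Matrix.toEuclideanLin M)
    (n := q) (by simp)
  have hW : (Matrix.of fun i j => b j i : Matrix (Fin q) (Fin q) ℝ)ᵀ *
      (Matrix.of fun i j => b j i) = 1 := by
    ext i j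
    have := orthonormal_iff_ite.1 b.orthonormal i j
    rw [Matrix.one_apply, ← this, PiLp.inner_apply, Matrix.mul_apply]
    exact Finset.sum_congr rfl fun k _ => mul_comm (b i k) (b j k)
  refine ⟨Matrix.of fun i j => b j i, fun i => (Matrix.toEuclideanLin M).singularValues i, hW,
    mul_eq_one_comm.1 hW, fun i => LinearMap.singularValues_nonneg _ i, ?_, rfl⟩
  ext i j
  rw [Matrix.diagonal_apply, ← hb i j, PiLp.inner_apply, Matrix.mul_apply]
  exact Finset.sum_congr rfl fun k _ => mul_comm (Matrix.toEuclideanLin M (b i) k)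
    (Matrix.toEuclideanLin M (b j) k)

theorem IsSVD.transpose_mul_mul {M : Matrix (Fin p) (Fin q) ℝ} {U : Matrix (Fin p) (Fin r) ℝ}
    {σ : Fin r → ℝ} {V : Matrix (Fin q) (Fin r) ℝ} (h : IsSVD M U σ V) :
    Uᵀ * M * V = Matrix.diagonal σ := by
  calc Uᵀ * M * V = (Uᵀ * U) * Matrix.diagonal σ * (Vᵀ * V) := by
        rw [h.eq]; simp only [Matrix.mul_assoc]
    _ = Matrix.diagonal σ := by rw [h.orthU, h.orthV, Matrix.one_mul, Matrix.mul_one]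

/-- Duality: the left side is the trace pairing of `M` with `U Vᵀ`, a contraction. In the basis `W`
the columns of `M` have norms `s j`, and Cauchy–Schwarz applies column by column. -/
theorem IsSVD.sum_le_nuclearNorm {M : Matrix (Fin p) (Fin q) ℝ} {U : Matrix (Fin p) (Fin r) ℝ}
    {σ : Fin r → ℝ} {V : Matrix (Fin q) (Fin r) ℝ} (h : IsSVD M U σ V) :
    ∑ i, σ i ≤ nuclearNorm M := by
  obtain ⟨W, s, hW, hW', hs, hg, hn⟩ := exists_orthogonal_gram_diagonal M
  have hcol : ∀ j, colNorm (M * W) j = s j := fun j => by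
    have := congrFun (congrFun hg j) j
    rw [Matrix.diagonal_apply_eq] at this
    rw [colNorm_eq_sqrt, ← Real.sqrt_sq (hs j), ← this]
    simp only [Matrix.mul_apply (M := (M * W)ᵀ), Matrix.transpose_apply, sq]
  have hUV : ‖U * Vᵀ‖ ≤ 1 :=
    (l2_opNorm_mul_le_of_le_one_left (l2_opNorm_le_one_of_orth h.orthU) _).trans
      ((l2_opNorm_transpose V).trans_le (l2_opNorm_le_one_of_orth h.orthV))
  calc ∑ i, σ i = (Uᵀ * M * V).trace := by rw [h.transpose_mul_mul, Matrix.trace_diagonal]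
    _ = (V * (Uᵀ * M) * (W * Wᵀ)).trace := by
        rw [hW', Matrix.mul_one, Matrix.trace_mul_comm]
    _ = ((U * Vᵀ * W)ᵀ * (M * W)).trace := by
        rw [← Matrix.mul_assoc, Matrix.trace_mul_comm]
        simp [Matrix.mul_assoc]
    _ ≤ ∑ j, colNorm (U * Vᵀ * W) j * colNorm (M * W) j := trace_transpose_mul_le _ _
    _ ≤ ∑ j, s j := Finset.sum_le_sum fun j _ => by
        have h1 : colNorm W j ≤ 1 := by
          have := congrFun (congrFun hW j) j
          rw [Matrix.one_apply_eq] at this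
          rw [colNorm_eq_sqrt, Real.sqrt_le_one, ← this]
          simp [Matrix.mul_apply, sq]
        rw [hcol]
        exact mul_le_of_le_one_left (hs j) ((colNorm_mul_le_of_le_one hUV W j).trans h1)
    _ = nuclearNorm M := hn.symm

/-- With `U` the polar factor, the nuclear norm is the pairing of `Aᵀ U` with `B W`. The inequality
`2⟨x, y⟩ ≤ ‖x‖² + ‖y‖²` bounds it, and neither `U` nor `W` increases Frobenius norms. -/
theorem two_mul_nuclearNorm_mul_le (A : Matrix (Fin p) (Fin r) ℝ) (B : Matrix (Fin r) (Fin q) ℝ) :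
    2 * nuclearNorm (A * B) ≤ (Aᵀ * A).trace + (Bᵀ * B).trace := by
  obtain ⟨W, s, hW, hW', hs, hg, hn⟩ := exists_orthogonal_gram_diagonal (A * B)
  -- Since `0⁻¹ = 0`, directions with `s i = 0` give zero columns, and `Uᵀ U` is diagonal with
  -- entries 0 or 1.
  set U := A * B * W * Matrix.diagonal fun i => (s i)⁻¹ with hU
  have hUM : Uᵀ * (A * B * W) = Matrix.diagonal s := by
    rw [hU, Matrix.transpose_mul, Matrix.mul_assoc, hg, Matrix.diagonal_transpose,
      Matrix.diagonal_mul_diagonal]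
    congr 1; ext i
    rcases eq_or_ne (s i) 0 with h | h
    · simp [h]
    · field_simp
  have hUU : ‖Uᵀ‖ ≤ 1 := by
    rw [l2_opNorm_transpose]
    refine l2_opNorm_le_one_of_transpose_mul_self ?_
    conv_lhs => rw [hU, ← Matrix.mul_assoc, ← hU, hUM, Matrix.diagonal_mul_diagonal]
    refine l2_opNorm_diagonal_le zero_le_one fun i => ?_
    rcases eq_or_ne (s i) 0 with h | h
    · simp [h]
    · simp [h]
  have hA : ((Aᵀ * U)ᵀ * (Aᵀ * U)).trace ≤ (Aᵀ * A).trace := by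
    calc ((Aᵀ * U)ᵀ * (Aᵀ * U)).trace = ((Uᵀ * A)ᵀ * (Uᵀ * A)).trace := by
          rw [Matrix.trace_mul_comm]; simp [Matrix.mul_assoc]
      _ ≤ (Aᵀ * A).trace := by
          rw [trace_transpose_mul_self, trace_transpose_mul_self]
          exact Finset.sum_le_sum fun j _ =>
            pow_le_pow_left₀ (colNorm_nonneg _ _) (colNorm_mul_le_of_le_one hUU A j) 2
  have hB : ((B * W)ᵀ * (B * W)).trace = (Bᵀ * B).trace := by
    calc ((B * W)ᵀ * (B * W)).trace = (Wᵀ * (Bᵀ * B * W)).trace := by simp [Matrix.mul_assoc]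
      _ = (Bᵀ * B * (W * Wᵀ)).trace := by rw [Matrix.trace_mul_comm, Matrix.mul_assoc]
      _ = _ := by rw [hW', Matrix.mul_one]
  calc 2 * nuclearNorm (A * B) = 2 * ((Aᵀ * U)ᵀ * (B * W)).trace := by
        rw [hn, ← Matrix.trace_diagonal, ← hUM]; simp [Matrix.mul_assoc]
    _ ≤ _ := two_mul_trace_transpose_mul_le _ _
    _ ≤ _ := by rw [hB]; gcongr

end NuclearNorm

/-! ### Column restriction as right multiplication by a diagonal projection. -/

section ColMask

variable {p q : ℕ}

/-- The diagonal projection onto the coordinates in `I`. -/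
def colMask (I : Finset (Fin q)) : Matrix (Fin q) (Fin q) ℝ :=
  Matrix.diagonal fun j => if j ∈ I then 1 else 0

theorem projCols_eq_mul (I : Finset (Fin q)) (M : Matrix (Fin p) (Fin q) ℝ) :
    projCols I M = M * colMask I := by
  ext i j
  simp [projCols, colMask]

theorem colMask_transpose (I : Finset (Fin q)) : (colMask I)ᵀ = colMask I :=
  Matrix.diagonal_transpose _

theorem colMask_mul_self (I : Finset (Fin q)) : colMask I * colMask I = colMask I := by
  rw [colMask, Matrix.diagonal_mul_diagonal]
  congr 1; ext j; split_ifs <;> simp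

theorem colMask_compl (I : Finset (Fin q)) : colMask Iᶜ = 1 - colMask I := by
  rw [colMask, colMask, ← Matrix.diagonal_one, Matrix.diagonal_sub]
  congr 1; ext j
  by_cases h : j ∈ I <;> simp [h]

theorem colMask_mul_compl (I : Finset (Fin q)) : colMask I * colMask Iᶜ = 0 := by
  rw [colMask_compl, mul_sub, mul_one, colMask_mul_self, sub_self]

theorem colMask_compl_mul (I : Finset (Fin q)) : colMask Iᶜ * colMask I = 0 := by
  rw [colMask_compl, sub_mul, one_mul, colMask_mul_self, sub_self]

theorem norm_colMask_le (I : Finset (Fin q)) : ‖colMask I‖ ≤ 1 :=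
  l2_opNorm_diagonal_le zero_le_one fun i => by split_ifs <;> simp

theorem apply_eq_zero_of_projCols_eq {I : Finset (Fin q)} {M : Matrix (Fin p) (Fin q) ℝ}
    (h : projCols I M = M) {j : Fin q} (hj : j ∉ I) (i : Fin p) : M i j = 0 := by
  rw [← h]; simp [projCols, hj]

theorem projCols_colSupport (M : Matrix (Fin p) (Fin q) ℝ) :
    projCols (colSupport M) M = M := by
  ext i j
  simp only [projCols, colSupport, Matrix.of_apply, Finset.mem_filter, Finset.mem_univ, true_and,
    ite_eq_left_iff, not_exists, not_not]
  exact fun h => (h i).symm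

theorem projCols_colNormalize (I : Finset (Fin q)) (M : Matrix (Fin p) (Fin q) ℝ) :
    projCols I (colNormalize I M) = colNormalize I M := by
  ext i j
  simp only [projCols, colNormalize, Matrix.of_apply]
  split_ifs <;> rfl

theorem colNormalize_eq_mul (I : Finset (Fin q)) (M : Matrix (Fin p) (Fin q) ℝ) :
    colNormalize I M = M * Matrix.diagonal fun j => if j ∈ I then (colNorm M j)⁻¹ else 0 := by
  ext i j
  simp [colNormalize, div_eq_mul_inv]

/-- The Frobenius norm dominates the spectral norm, and each column in `I` has norm at most 1 (a
zero column stays zero, as `0 / 0 = 0`). -/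
theorem norm_colNormalize_le (I : Finset (Fin q)) (M : Matrix (Fin p) (Fin q) ℝ) :
    ‖colNormalize I M‖ ≤ √I.card := by
  refine (l2_opNorm_le_sqrt_sum _).trans (Real.sqrt_le_sqrt ?_)
  have h : ∀ j, colNorm (colNormalize I M) j ^ 2 ≤ if j ∈ I then 1 else 0 := fun j => by
    rw [colNorm_sq]
    by_cases hj : j ∈ I
    · simp only [colNormalize, Matrix.of_apply, hj, if_true, div_pow, ← Finset.sum_div]
      rw [← colNorm_sq]
      exact div_self_le_one _
    · simp [colNormalize, hj]
  exact (Finset.sum_le_sum fun j _ => h j).trans (by simp)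

end ColMask

/-! ### Algebra of a thin SVD and its pseudoinverse. -/

section SVD

variable {p q r : ℕ} {M : Matrix (Fin p) (Fin q) ℝ} {U : Matrix (Fin p) (Fin r) ℝ}
  {σ : Fin r → ℝ} {V : Matrix (Fin q) (Fin r) ℝ}

theorem IsSVD.diagonal_inv_mul (h : IsSVD M U σ V) :
    Matrix.diagonal σ⁻¹ * Matrix.diagonal σ = 1 := by
  rw [Matrix.diagonal_mul_diagonal, ← Matrix.diagonal_one]
  congr 1; ext i
  exact inv_mul_cancel₀ (h.pos i).ne'

theorem IsSVD.diagonal_mul_inv (h : IsSVD M U σ V) :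
    Matrix.diagonal σ * Matrix.diagonal σ⁻¹ = 1 :=
  mul_eq_one_comm.1 h.diagonal_inv_mul

theorem IsSVD.mul_right (h : IsSVD M U σ V) : M * V = U * Matrix.diagonal σ := by
  rw [h.eq, Matrix.mul_assoc, h.orthV, Matrix.mul_one]

theorem IsSVD.mul_left (h : IsSVD M U σ V) : Uᵀ * M = Matrix.diagonal σ * Vᵀ := by
  rw [h.eq, Matrix.mul_assoc, ← Matrix.mul_assoc, h.orthU, Matrix.one_mul]

theorem IsSVD.left_eq (h : IsSVD M U σ V) : U = M * V * Matrix.diagonal σ⁻¹ := by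
  rw [h.mul_right, Matrix.mul_assoc, h.diagonal_mul_inv, Matrix.mul_one]

theorem IsSVD.right_eq (h : IsSVD M U σ V) : Vᵀ = Matrix.diagonal σ⁻¹ * (Uᵀ * M) := by
  rw [h.mul_left, ← Matrix.mul_assoc, h.diagonal_inv_mul, Matrix.one_mul]

theorem IsSVD.left_proj (h : IsSVD M U σ V) : U * Uᵀ * M = M := by
  rw [Matrix.mul_assoc, h.mul_left, ← Matrix.mul_assoc, ← h.eq]

theorem IsSVD.right_proj (h : IsSVD M U σ V) : V * Vᵀ * Mᵀ = Mᵀ := by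
  rw [h.eq]
  simp only [Matrix.transpose_mul, Matrix.transpose_transpose, Matrix.mul_assoc]
  rw [← Matrix.mul_assoc Vᵀ, h.orthV, Matrix.one_mul]

/-- `U Σ⁻¹ Vᵀ` is a right inverse of `Mᵀ` on the row space of `M`. -/
theorem IsSVD.transpose_mul_pinv (h : IsSVD M U σ V) :
    Mᵀ * (U * Matrix.diagonal σ⁻¹ * Vᵀ) = V * Vᵀ := by
  calc Mᵀ * (U * Matrix.diagonal σ⁻¹ * Vᵀ) = (Uᵀ * M)ᵀ * (Matrix.diagonal σ⁻¹ * Vᵀ) := by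
        simp [Matrix.mul_assoc]
    _ = V * (Matrix.diagonal σ * Matrix.diagonal σ⁻¹ * Vᵀ) := by
        rw [h.mul_left]
        simp only [Matrix.transpose_mul, Matrix.diagonal_transpose, Matrix.transpose_transpose,
          Matrix.mul_assoc]
    _ = V * Vᵀ := by rw [h.diagonal_mul_inv, Matrix.one_mul]

theorem IsSVD.pinv_mul_transpose (h : IsSVD M U σ V) :
    U * Matrix.diagonal σ⁻¹ * Vᵀ * Mᵀ = U * Uᵀ := by
  calc U * Matrix.diagonal σ⁻¹ * Vᵀ * Mᵀ = U * Matrix.diagonal σ⁻¹ * (M * V)ᵀ := by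
        simp [Matrix.mul_assoc]
    _ = U * (Matrix.diagonal σ⁻¹ * Matrix.diagonal σ * Uᵀ) := by
        rw [h.mul_right]
        simp only [Matrix.transpose_mul, Matrix.diagonal_transpose, Matrix.mul_assoc]
    _ = U * Uᵀ := by rw [h.diagonal_inv_mul, Matrix.one_mul]

end SVD

/-! ### First-order optimality for the oracle problem. -/

section Stationarity

variable {d n r s : ℕ}

theorem eq_zero_of_forall_le_add_sq {a K : ℝ} (h : ∀ t : ℝ, 0 ≤ t * a + K * t ^ 2) : a = 0 := by
  have hK : 0 < |K| + 1 := by positivity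
  -- With `|K| + 1` in place of `K` the denominator is positive for every `K`, and the quadratic
  -- bound collapses to `-a² / (|K| + 1)²`.
  have h1 := h (-a / (|K| + 1))
  have h2 : 0 ≤ -a / (|K| + 1) * a + |K| * (-a / (|K| + 1)) ^ 2 :=
    h1.trans (by gcongr; exact le_abs_self K)
  have h3 : -a / (|K| + 1) * a + |K| * (-a / (|K| + 1)) ^ 2 = -(a ^ 2 / (|K| + 1) ^ 2) := by
    field_simp; ring
  rw [h3] at h2
  have h4 : a ^ 2 / (|K| + 1) ^ 2 ≤ 0 := by linarith
  have h5 : a ^ 2 ≤ 0 := by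
    by_contra hc
    exact absurd h4 (not_le.2 (div_pos (not_le.1 hc) (by positivity)))
  nlinarith [sq_nonneg a]

/-- The factorization bound is tight at `Z = (U √Σ)(√Σ Vᵀ)`. As `E` has its columns in the range of
`U`, the perturbation can be put entirely into the right factor, as `t Σ^{-1/2} Uᵀ E`; expanding its
squared Frobenius norm gives a quadratic in `t`. -/
theorem IsSVD.nuclearNorm_add_smul_le {Z E : Matrix (Fin n) (Fin n) ℝ}
    {U V : Matrix (Fin n) (Fin s) ℝ} {σ : Fin s → ℝ} (h : IsSVD Z U σ V) (hE : U * Uᵀ * E = E) :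
    ∃ K : ℝ, ∀ t : ℝ, nuclearNorm (Z + t • E) ≤
      nuclearNorm Z + t * ((U * Vᵀ)ᵀ * E).trace + K * t ^ 2 := by
  set D := Matrix.diagonal fun i => √(σ i) with hD
  set D' := Matrix.diagonal fun i => (√(σ i))⁻¹ with hD'
  have hDD : D * D = Matrix.diagonal σ := by
    rw [hD, Matrix.diagonal_mul_diagonal]
    congr 1; ext i; exact Real.mul_self_sqrt (h.pos i).le
  have hDD' : D * D' = 1 := by
    rw [hD, hD', Matrix.diagonal_mul_diagonal, ← Matrix.diagonal_one]
    congr 1; ext i; exact mul_inv_cancel₀ (Real.sqrt_pos.2 (h.pos i)).ne'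
  have hDt : Dᵀ = D := Matrix.diagonal_transpose _
  refine ⟨((D' * (Uᵀ * E))ᵀ * (D' * (Uᵀ * E))).trace / 2, fun t => ?_⟩
  have hfac : Z + t • E = U * D * (D * Vᵀ + t • (D' * (Uᵀ * E))) := by
    calc Z + t • E = U * (D * D) * Vᵀ + t • (U * (D * D') * Uᵀ * E) := by
          rw [hDD, hDD', ← h.eq, Matrix.mul_one, hE]
      _ = _ := by simp [Matrix.mul_assoc, Matrix.mul_add]
  have h1 : ((U * D)ᵀ * (U * D)).trace = ∑ i, σ i := by
    rw [Matrix.transpose_mul, Matrix.mul_assoc, ← Matrix.mul_assoc Uᵀ, h.orthU, Matrix.one_mul, hDt,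
      hDD, Matrix.trace_diagonal]
  have h2 : ((D * Vᵀ)ᵀ * (D * Vᵀ)).trace = ∑ i, σ i := by
    rw [Matrix.trace_mul_comm, Matrix.transpose_mul, Matrix.transpose_transpose, Matrix.mul_assoc,
      ← Matrix.mul_assoc Vᵀ, h.orthV, Matrix.one_mul, hDt, hDD, Matrix.trace_diagonal]
  have h3 : (D * Vᵀ)ᵀ * (D' * (Uᵀ * E)) = (U * Vᵀ)ᵀ * E := by
    calc (D * Vᵀ)ᵀ * (D' * (Uᵀ * E)) = V * (D * D') * (Uᵀ * E) := by
          rw [Matrix.transpose_mul, hDt]; simp [Matrix.mul_assoc]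
      _ = _ := by rw [hDD']; simp [Matrix.mul_assoc]
  have h4 := two_mul_nuclearNorm_mul_le (U * D) (D * Vᵀ + t • (D' * (Uᵀ * E)))
  rw [← hfac, h1, Matrix.transpose_add, Matrix.add_mul, Matrix.mul_add, Matrix.mul_add,
    Matrix.transpose_smul] at h4
  simp only [Matrix.trace_add, Matrix.smul_mul, Matrix.mul_smul, Matrix.trace_smul,
    smul_eq_mul] at h4
  rw [trace_transpose_mul_comm (D' * (Uᵀ * E)) (D * Vᵀ), h2, h3] at h4
  have h5 := h.sum_le_nuclearNorm
  linarith

theorem colNorm_sub_smul_le (C Y : Matrix (Fin d) (Fin n) ℝ) {j : Fin n} (hj : 0 < colNorm C j)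
    (t : ℝ) : colNorm (C - t • Y) j ≤ colNorm C j - t * ∑ i, C i j / colNorm C j * Y i j +
      colNorm Y j ^ 2 / (2 * colNorm C j) * t ^ 2 := by
  set a := colNorm C j with ha
  have h1 : colNorm (C - t • Y) j ^ 2 =
      a ^ 2 - 2 * t * ∑ i, C i j * Y i j + colNorm Y j ^ 2 * t ^ 2 := by
    rw [ha, colNorm_sq, colNorm_sq, colNorm_sq, Finset.mul_sum, Finset.sum_mul,
      ← Finset.sum_sub_distrib, ← Finset.sum_add_distrib]
    refine Finset.sum_congr rfl fun i _ => ?_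
    simp only [Matrix.sub_apply, Matrix.smul_apply, smul_eq_mul]
    ring
  have h2 : ∑ i, C i j / a * Y i j = (∑ i, C i j * Y i j) / a := by
    rw [Finset.sum_div]
    exact Finset.sum_congr rfl fun i _ => by ring
  -- The inequality `b ≤ (b² + a²) / (2a)` replaces the norm by its square, which is exactly
  -- quadratic in `t`.
  have h3 : colNorm (C - t • Y) j ≤ (colNorm (C - t • Y) j ^ 2 + a ^ 2) / (2 * a) := by
    rw [le_div_iff₀ (by positivity)]
    nlinarith [sq_nonneg (colNorm (C - t • Y) j - a)]
  refine h3.trans_eq ?_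
  rw [h1, h2]
  field_simp
  ring

theorem norm21_sub_smul_le {I : Finset (Fin n)} {C Y : Matrix (Fin d) (Fin n) ℝ}
    (hCI : projCols I C = C) (hYI : projCols I Y = Y) (hC : ∀ j ∈ I, 0 < colNorm C j) :
    ∃ K : ℝ, ∀ t : ℝ, norm21 (C - t • Y) ≤
      norm21 C - t * ((colNormalize I C)ᵀ * Y).trace + K * t ^ 2 := by
  refine ⟨∑ j, colNorm Y j ^ 2 / (2 * colNorm C j), fun t => ?_⟩
  rw [trace_transpose_mul, norm21, norm21, Finset.mul_sum, Finset.sum_mul,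
    ← Finset.sum_sub_distrib, ← Finset.sum_add_distrib]
  refine Finset.sum_le_sum fun j _ => ?_
  by_cases hj : j ∈ I
  · simpa [colNormalize, hj] using colNorm_sub_smul_le C Y (hC j hj) t
  · have h1 := apply_eq_zero_of_projCols_eq hCI hj
    have h2 := apply_eq_zero_of_projCols_eq hYI hj
    have h3 : ∀ i, (C - t • Y) i j = 0 := fun i => by simp [h1, h2]
    rw [colNorm_eq_zero.2 h1, colNorm_eq_zero.2 h2, colNorm_eq_zero.2 h3]
    simp [colNormalize, hj]

/-- The pair `(Z + tE, C - tXE)` is feasible for every real `t`. Optimality and the two quadratic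
upper bounds force the linear coefficient to vanish. -/
theorem IsOracleSolution.trace_eq {X : Matrix (Fin d) (Fin n) ℝ} {V₀ : Matrix (Fin n) (Fin r) ℝ}
    {I : Finset (Fin n)} {lam : ℝ} (hlam : 0 < lam) {Z : Matrix (Fin n) (Fin n) ℝ}
    {C : Matrix (Fin d) (Fin n) ℝ} (hsol : IsOracleSolution X V₀ I lam Z C)
    {U V : Matrix (Fin n) (Fin s) ℝ} {σ : Fin s → ℝ} (h : IsSVD Z U σ V)
    (hC : ∀ j ∈ I, 0 < colNorm C j) {E : Matrix (Fin n) (Fin n) ℝ}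
    (hEU : U * Uᵀ * E = E) (hEV : projL V₀ E = E) (hEI : projCols I E = E) :
    ((U * Vᵀ)ᵀ * E).trace = lam * ((colNormalize I C)ᵀ * (X * E)).trace := by
  have hYI : projCols I (X * E) = X * E := by
    rw [projCols_eq_mul, Matrix.mul_assoc, ← projCols_eq_mul, hEI]
  obtain ⟨K₁, hK₁⟩ := h.nuclearNorm_add_smul_le hEU
  obtain ⟨K₂, hK₂⟩ := norm21_sub_smul_le hsol.feasible.supp hYI hC
  refine sub_eq_zero.1 (eq_zero_of_forall_le_add_sq (K := K₁ + lam * K₂) fun t => ?_)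
  have hfeas : OracleFeasible X V₀ I (Z + t • E) (C - t • (X * E)) := by
    refine ⟨?_, ?_, ?_⟩
    · rw [Matrix.mul_add, Matrix.mul_smul]
      conv_lhs => rw [hsol.feasible.data]
      abel
    · have h1 := hsol.feasible.row
      rw [projL] at h1 hEV ⊢
      rw [Matrix.mul_add, Matrix.mul_smul, h1, hEV]
    · have h1 := hsol.feasible.supp
      rw [projCols_eq_mul] at h1 hYI ⊢
      rw [Matrix.sub_mul, Matrix.smul_mul, h1, hYI]
  have h1 := hsol.optimal _ _ hfeas
  have h2 := hK₁ t
  have h3 := mul_le_mul_of_nonneg_left (hK₂ t) hlam.le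
  linarith

end Stationarity

/-! ### The Neumann series of `P_V P_I P_V`. -/

section Neumann

variable {p n r : ℕ} {I : Finset (Fin n)} {V : Matrix (Fin n) (Fin r) ℝ}

theorem gram_eq : gram I V = Vᵀ * colMask I * V := by
  rw [gram, projCols_eq_mul, Matrix.transpose_mul, Matrix.transpose_transpose, colMask_transpose,
    Matrix.mul_assoc, ← Matrix.mul_assoc (colMask I), colMask_mul_self, Matrix.mul_assoc]

/-- The matrix by which `P_V P_I P_V` multiplies from the right. -/
def sandwichMatrix (I : Finset (Fin n)) (V : Matrix (Fin n) (Fin r) ℝ) :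
    Matrix (Fin n) (Fin n) ℝ :=
  V * Vᵀ * colMask I * (V * Vᵀ)

theorem sandwich_eq (M : Matrix (Fin p) (Fin n) ℝ) :
    sandwich I V M = M * sandwichMatrix I V := by
  simp only [sandwich, projR, projCols_eq_mul, sandwichMatrix, Matrix.mul_assoc]

theorem sandwich_iterate (M : Matrix (Fin p) (Fin n) ℝ) (i : ℕ) :
    (sandwich I V)^[i] M = M * sandwichMatrix I V ^ i := by
  induction i with
  | zero => simp
  | succ i ih => rw [Function.iterate_succ_apply', ih, sandwich_eq, pow_succ, Matrix.mul_assoc]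

theorem proj_mul_self (hV : Vᵀ * V = 1) : V * Vᵀ * (V * Vᵀ) = V * Vᵀ := by
  rw [Matrix.mul_assoc, ← Matrix.mul_assoc Vᵀ, hV, Matrix.one_mul]

theorem norm_proj_le (hV : Vᵀ * V = 1) : ‖V * Vᵀ‖ ≤ 1 :=
  (l2_opNorm_mul_le_of_le_one_left (l2_opNorm_le_one_of_orth hV) _).trans
    ((l2_opNorm_transpose V).trans_le (l2_opNorm_le_one_of_orth hV))

/-- The sandwich equals `V G Vᵀ` with `G` the Gram matrix, and `V`, `Vᵀ` are contractions. -/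
theorem norm_sandwichMatrix_le (hV : Vᵀ * V = 1) : ‖sandwichMatrix I V‖ ≤ ‖gram I V‖ := by
  have h1 : sandwichMatrix I V = V * (gram I V * Vᵀ) := by
    simp only [gram_eq, sandwichMatrix, Matrix.mul_assoc]
  rw [h1]
  exact (l2_opNorm_mul_le_of_le_one_left (l2_opNorm_le_one_of_orth hV) _).trans
    (l2_opNorm_mul_le_of_le_one_right
      ((l2_opNorm_transpose V).trans_le (l2_opNorm_le_one_of_orth hV)) _)

theorem proj_mul_sandwichMatrix (hV : Vᵀ * V = 1) :
    V * Vᵀ * sandwichMatrix I V = sandwichMatrix I V := by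
  simp only [sandwichMatrix, ← mul_assoc (V * Vᵀ), proj_mul_self hV]

theorem sandwichMatrix_mul_proj (hV : Vᵀ * V = 1) :
    sandwichMatrix I V * (V * Vᵀ) = sandwichMatrix I V := by
  simp only [sandwichMatrix, mul_assoc _ (V * Vᵀ) (V * Vᵀ), proj_mul_self hV]

theorem sandwichMatrix_compl (hV : Vᵀ * V = 1) :
    sandwichMatrix Iᶜ V = V * Vᵀ - sandwichMatrix I V := by
  rw [sandwichMatrix, colMask_compl, mul_sub, sub_mul, mul_one, proj_mul_self hV, sandwichMatrix]

/-- The sum of the Neumann series of `P_V P_I P_V`, as a matrix multiplying from the right. -/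
def neumannMatrix (I : Finset (Fin n)) (V : Matrix (Fin n) (Fin r) ℝ) :
    Matrix (Fin n) (Fin n) ℝ :=
  ∑' i : ℕ, sandwichMatrix I V ^ i

theorem neumannMatrix_mul (h : ‖sandwichMatrix I V‖ < 1) :
    neumannMatrix I V * (1 - sandwichMatrix I V) = 1 :=
  geom_series_mul_neg _ h

theorem mul_neumannMatrix (h : ‖sandwichMatrix I V‖ < 1) :
    (1 - sandwichMatrix I V) * neumannMatrix I V = 1 :=
  mul_neg_geom_series _ h

theorem norm_neumannMatrix_le {c : ℝ} (hc : ‖sandwichMatrix I V‖ ≤ c) (hc1 : c < 1) :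
    ‖neumannMatrix I V‖ ≤ 1 / (1 - c) := by
  have h1 : neumannMatrix I V = 1 + sandwichMatrix I V * neumannMatrix I V := by
    rw [← sub_eq_iff_eq_add, ← mul_neumannMatrix (hc.trans_lt hc1), sub_mul, one_mul]
  have h2 : ‖neumannMatrix I V‖ ≤ 1 + c * ‖neumannMatrix I V‖ := by
    conv_lhs => rw [h1]
    refine (norm_add_le _ _).trans (add_le_add l2_opNorm_one_le ?_)
    exact (norm_mul_le _ _).trans (mul_le_mul_of_nonneg_right hc (norm_nonneg _))
  rw [le_div_iff₀ (by linarith)]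
  linarith

theorem proj_commute_neumannMatrix (hV : Vᵀ * V = 1) (h : ‖sandwichMatrix I V‖ < 1) :
    V * Vᵀ * neumannMatrix I V = neumannMatrix I V * (V * Vᵀ) := by
  set P := V * Vᵀ
  set S := sandwichMatrix I V
  set R := neumannMatrix I V
  have hPS : P * (1 - S) = (1 - S) * P := by
    rw [mul_sub, sub_mul, mul_one, one_mul, proj_mul_sandwichMatrix hV, sandwichMatrix_mul_proj hV]
  calc P * R = (R * (1 - S)) * P * R := by rw [neumannMatrix_mul h, one_mul]
    _ = R * (P * ((1 - S) * R)) := by rw [mul_assoc R, ← hPS]; simp only [mul_assoc]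
    _ = R * P := by rw [mul_neumannMatrix h, mul_one]

theorem hasSum_sandwich_iterate (h : ‖sandwichMatrix I V‖ < 1) (M : Matrix (Fin p) (Fin n) ℝ) :
    HasSum (fun i : ℕ => (sandwich I V)^[i + 1] M)
      (M * (neumannMatrix I V - 1)) := by
  simp only [sandwich_iterate]
  have h1 := (hasSum_nat_add_iff' 1).2 (summable_geometric_of_norm_lt_one h).hasSum
  rw [Finset.sum_range_one, pow_zero] at h1
  exact h1.map (Matrix.addMonoidHomMulLeft M) (continuous_const.matrix_mul continuous_id)

theorem neumann_eq (h : ‖sandwichMatrix I V‖ < 1) (M : Matrix (Fin p) (Fin n) ℝ) :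
    neumann I V M = M * neumannMatrix I V := by
  rw [neumann, (hasSum_sandwich_iterate h M).tsum_eq, Matrix.mul_sub, Matrix.mul_one]
  abel

/-- The complementary sandwich is `V Vᵀ - S`, which acts as `1 - S` on the range of `P_V`; the
Neumann sum inverts `1 - S` and commutes with `V Vᵀ`. -/
theorem invOn_neumann_sandwich (hV : Vᵀ * V = 1) (h : ‖sandwichMatrix I V‖ < 1) :
    Set.InvOn (neumann I V) (sandwich Iᶜ V) {M : Matrix (Fin p) (Fin n) ℝ | projR V M = M}
      {M | projR V M = M} := by
  constructor <;> intro M hM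
  · have hM' : M * (V * Vᵀ) = M := hM
    calc neumann I V (sandwich Iᶜ V M)
        = (M * (V * Vᵀ) - M * sandwichMatrix I V) * neumannMatrix I V := by
          rw [sandwich_eq, neumann_eq h, sandwichMatrix_compl hV, Matrix.mul_sub]
      _ = M * ((1 - sandwichMatrix I V) * neumannMatrix I V) := by
          rw [hM', ← Matrix.mul_assoc, Matrix.mul_sub, Matrix.mul_one]
      _ = M := by rw [mul_neumannMatrix h, Matrix.mul_one]
  · have hM' : M * (V * Vᵀ) = M := hM
    calc sandwich Iᶜ V (neumann I V M)
        = M * (neumannMatrix I V * (V * Vᵀ)) - M * neumannMatrix I V * sandwichMatrix I V := by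
          rw [sandwich_eq, neumann_eq h, sandwichMatrix_compl hV, Matrix.mul_sub, Matrix.mul_assoc]
      _ = M * (neumannMatrix I V * (1 - sandwichMatrix I V)) := by
          rw [← proj_commute_neumannMatrix hV h, ← Matrix.mul_assoc, hM', Matrix.mul_sub,
            Matrix.mul_one, Matrix.mul_sub, Matrix.mul_assoc]
      _ = M := by rw [neumannMatrix_mul h, Matrix.mul_one]

end Neumann

/-! ### Structure of the oracle solution. -/

section Oracle

variable {d n r₀ rX s : ℕ} {X X₀ C₀ C : Matrix (Fin d) (Fin n) ℝ} {I : Finset (Fin n)}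
  {U₀ : Matrix (Fin d) (Fin r₀) ℝ} {σ₀ : Fin r₀ → ℝ} {V₀ : Matrix (Fin n) (Fin r₀) ℝ}
  {UX : Matrix (Fin d) (Fin rX) ℝ} {σX : Fin rX → ℝ} {VX : Matrix (Fin n) (Fin rX) ℝ}
  {Z : Matrix (Fin n) (Fin n) ℝ} {U V : Matrix (Fin n) (Fin s) ℝ} {σ : Fin s → ℝ} {lam : ℝ}

theorem right_transpose_mul_colMask (h₀ : IsSVD X₀ U₀ σ₀ V₀) (hX₀ : X₀ * colMask I = 0) :
    V₀ᵀ * colMask I = 0 := by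
  rw [h₀.right_eq, Matrix.mul_assoc, Matrix.mul_assoc, hX₀, Matrix.mul_zero, Matrix.mul_zero]

theorem mul_colMask_compl_eq (hX : X = X₀ + C₀) (hX₀ : X₀ * colMask I = 0)
    (hC₀ : C₀ * colMask I = C₀) : X * colMask Iᶜ = X₀ := by
  rw [hX, colMask_compl, Matrix.mul_sub, Matrix.mul_one, Matrix.add_mul, hX₀, hC₀]
  abel

/-- On the columns outside `I` the term `C` drops out and `X` becomes `X₀`. Since `V₀` vanishes on
the rows in `I`, also `X V₀ = X₀ V₀`, so `Σ₀⁻¹ U₀ᵀ` can be cancelled. -/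
theorem right_transpose_mul_solution (h₀ : IsSVD X₀ U₀ σ₀ V₀) (hX : X = X₀ + C₀)
    (hX₀ : X₀ * colMask I = 0) (hC₀ : C₀ * colMask I = C₀) (hf : OracleFeasible X V₀ I Z C) :
    V₀ᵀ * Z * colMask Iᶜ = V₀ᵀ := by
  have hZ : V₀ * V₀ᵀ * Z = Z := hf.row
  have hC : C * colMask Iᶜ = 0 := by
    rw [← hf.supp, projCols_eq_mul, Matrix.mul_assoc, colMask_mul_compl, Matrix.mul_zero]
  have hDV : colMask I * V₀ = 0 := by
    rw [← colMask_transpose, ← Matrix.transpose_transpose V₀, ← Matrix.transpose_mul,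
      right_transpose_mul_colMask h₀ hX₀, Matrix.transpose_zero]
  have hXV : X * V₀ = X₀ * V₀ := by
    rw [hX, Matrix.add_mul, ← hC₀, Matrix.mul_assoc C₀, hDV, Matrix.mul_zero, add_zero]
  have h1 : X₀ = X₀ * V₀ * (V₀ᵀ * Z * colMask Iᶜ) := by
    calc X₀ = X * colMask Iᶜ := (mul_colMask_compl_eq hX hX₀ hC₀).symm
      _ = X * Z * colMask Iᶜ := by
          conv_lhs => rw [hf.data, Matrix.add_mul, hC, add_zero]
      _ = X * V₀ * (V₀ᵀ * Z * colMask Iᶜ) := by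
          conv_lhs => rw [← hZ]
          simp only [Matrix.mul_assoc]
      _ = _ := by rw [hXV]
  have h2 : V₀ᵀ * V₀ * (V₀ᵀ * Z * colMask Iᶜ) = V₀ᵀ := by
    calc V₀ᵀ * V₀ * (V₀ᵀ * Z * colMask Iᶜ)
        = Matrix.diagonal σ₀⁻¹ * (U₀ᵀ * X₀) * V₀ * (V₀ᵀ * Z * colMask Iᶜ) := by rw [← h₀.right_eq]
      _ = Matrix.diagonal σ₀⁻¹ * (U₀ᵀ * (X₀ * V₀ * (V₀ᵀ * Z * colMask Iᶜ))) := by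
          simp only [Matrix.mul_assoc]
      _ = V₀ᵀ := by rw [← h1, ← h₀.right_eq]
  rwa [h₀.orthV, Matrix.one_mul] at h2

/-- Both inclusions of column spaces hold: `V₀ V₀ᵀ = Z Dᶜ` puts that of `V₀` inside that of `Z`, and
`V₀ V₀ᵀ Z = Z` gives the converse. -/
theorem left_proj_eq (hZD : V₀ᵀ * Z * colMask Iᶜ = V₀ᵀ) (hZ : V₀ * V₀ᵀ * Z = Z)
    (h : IsSVD Z U σ V) : U * Uᵀ = V₀ * V₀ᵀ := by
  have h1 : V₀ * V₀ᵀ = Z * colMask Iᶜ := by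
    conv_lhs => rw [← hZD, ← Matrix.mul_assoc, ← Matrix.mul_assoc, hZ]
  have h2 : U * Uᵀ * (V₀ * V₀ᵀ) = V₀ * V₀ᵀ := by
    rw [h1, ← Matrix.mul_assoc, h.left_proj]
  have h3 : V₀ * V₀ᵀ * U = U := by
    rw [h.left_eq, ← Matrix.mul_assoc, ← Matrix.mul_assoc, hZ]
  have h4 : V₀ * V₀ᵀ * (U * Uᵀ) = U * Uᵀ := by rw [← Matrix.mul_assoc, h3]
  have h5 := congrArg Matrix.transpose h4
  simp only [Matrix.transpose_mul, Matrix.transpose_transpose] at h5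
  exact h5.symm.trans h2

/-- Restricting `Z` to the clean columns gives the projection `U Uᵀ`, so `Uᵀ = Σ Vᵀ Dᶜ` and `Σ⁻¹ =
Vᵀ Dᶜ U` is a product of contractions. -/
theorem norm_diagonal_inv_le_one (hZD : V₀ᵀ * Z * colMask Iᶜ = V₀ᵀ) (hZ : V₀ * V₀ᵀ * Z = Z)
    (h : IsSVD Z U σ V) : ‖Matrix.diagonal σ⁻¹‖ ≤ 1 := by
  have h1 : V₀ * V₀ᵀ = Z * colMask Iᶜ := by
    conv_lhs => rw [← hZD, ← Matrix.mul_assoc, ← Matrix.mul_assoc, hZ]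
  have h2 : Uᵀ = Matrix.diagonal σ * (Vᵀ * colMask Iᶜ) := by
    calc Uᵀ = Uᵀ * (U * Uᵀ) := by rw [← Matrix.mul_assoc, h.orthU, Matrix.one_mul]
      _ = Uᵀ * Z * colMask Iᶜ := by rw [left_proj_eq hZD hZ h, h1, Matrix.mul_assoc]
      _ = _ := by rw [h.mul_left, Matrix.mul_assoc]
  have h3 : Matrix.diagonal σ⁻¹ = Vᵀ * (colMask Iᶜ * U) := by
    calc Matrix.diagonal σ⁻¹ = Matrix.diagonal σ⁻¹ * (Uᵀ * U) := by rw [h.orthU, Matrix.mul_one]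
      _ = Matrix.diagonal σ⁻¹ * Matrix.diagonal σ * (Vᵀ * (colMask Iᶜ * U)) := by
          rw [h2]; simp only [Matrix.mul_assoc]
      _ = _ := by rw [h.diagonal_inv_mul, Matrix.one_mul]
  rw [h3]
  exact (l2_opNorm_mul_le_of_le_one_left
    ((l2_opNorm_transpose V).trans_le (l2_opNorm_le_one_of_orth h.orthV)) _).trans
    ((l2_opNorm_mul_le_of_le_one_left (norm_colMask_le _) _).trans
      (l2_opNorm_le_one_of_orth h.orthU))

theorem transpose_Vbar : (Vbar U V V₀)ᵀ = V₀ᵀ * U * Vᵀ := by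
  simp only [Vbar, Matrix.transpose_mul, Matrix.transpose_transpose, Matrix.mul_assoc]

theorem mul_transpose_Vbar (h : IsSVD Z U σ V) (hU : U * Uᵀ = V₀ * V₀ᵀ) :
    V₀ * (Vbar U V V₀)ᵀ = U * Vᵀ := by
  rw [transpose_Vbar, ← Matrix.mul_assoc, ← Matrix.mul_assoc, ← hU, Matrix.mul_assoc U, h.orthU,
    Matrix.mul_one]

theorem Vbar_mul_transpose (h : IsSVD Z U σ V) (hU : U * Uᵀ = V₀ * V₀ᵀ) :
    Vbar U V V₀ * (Vbar U V V₀)ᵀ = V * Vᵀ := by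
  calc Vbar U V V₀ * (Vbar U V V₀)ᵀ = V * Uᵀ * (V₀ * (Vbar U V V₀)ᵀ) :=
        Matrix.mul_assoc _ _ _
    _ = V * Vᵀ := by
        rw [mul_transpose_Vbar h hU, Matrix.mul_assoc, ← Matrix.mul_assoc Uᵀ, h.orthU,
          Matrix.one_mul]

theorem Vbar_orth (h : IsSVD Z U σ V) (hU : U * Uᵀ = V₀ * V₀ᵀ) (hV₀ : V₀ᵀ * V₀ = 1) :
    (Vbar U V V₀)ᵀ * Vbar U V V₀ = 1 := by
  calc (Vbar U V V₀)ᵀ * Vbar U V V₀ = V₀ᵀ * U * (Vᵀ * V) * (Uᵀ * V₀) := by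
        rw [transpose_Vbar, Vbar]; simp only [Matrix.mul_assoc]
    _ = V₀ᵀ * (U * Uᵀ) * V₀ := by rw [h.orthV, Matrix.mul_one]; simp only [Matrix.mul_assoc]
    _ = V₀ᵀ * V₀ * (V₀ᵀ * V₀) := by rw [hU]; simp only [Matrix.mul_assoc]
    _ = 1 := by rw [hV₀, Matrix.one_mul]

theorem mul_colMask_apply_of_mem {p : ℕ} {J : Finset (Fin n)} {j : Fin n} (hj : j ∈ J)
    (M : Matrix (Fin p) (Fin n) ℝ) (i : Fin p) : (M * colMask J) i j = M i j := by
  rw [← projCols_eq_mul]; simp [projCols, hj]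

/-- Inserting `Σ⁻¹ Σ` costs nothing because `Σ⁻¹` is a contraction; the columns of `Σ Vᵀ` have the
norms of those of `Z`, hence of `V₀ᵀ Z`, which agrees with `V₀ᵀ` off `I`. -/
theorem colNorm_Vbar_le (hV₀ : V₀ᵀ * V₀ = 1) (hZD : V₀ᵀ * Z * colMask Iᶜ = V₀ᵀ)
    (hZ : V₀ * V₀ᵀ * Z = Z) (h : IsSVD Z U σ V) {i : Fin n} (hi : i ∉ I) :
    colNorm (Vbar U V V₀)ᵀ i ≤ colNorm V₀ᵀ i := by
  have hV₀U : ‖V₀ᵀ * U‖ ≤ 1 :=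
    (l2_opNorm_mul_le_of_le_one_left
      ((l2_opNorm_transpose V₀).trans_le (l2_opNorm_le_one_of_orth hV₀)) _).trans
      (l2_opNorm_le_one_of_orth h.orthU)
  calc colNorm (Vbar U V V₀)ᵀ i ≤ colNorm Vᵀ i := by
        rw [transpose_Vbar]; exact colNorm_mul_le_of_le_one hV₀U _ _
    _ = colNorm (Matrix.diagonal σ⁻¹ * (Matrix.diagonal σ * Vᵀ)) i := by
        rw [← Matrix.mul_assoc, h.diagonal_inv_mul, Matrix.one_mul]
    _ ≤ colNorm (Matrix.diagonal σ * Vᵀ) i :=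
        colNorm_mul_le_of_le_one (norm_diagonal_inv_le_one hZD hZ h) _ _
    _ = colNorm Z i := by
        rw [← colNorm_orth_mul h.orthU, ← Matrix.mul_assoc, ← h.eq]
    _ = colNorm (V₀ᵀ * Z) i := by
        rw [← colNorm_orth_mul hV₀ (V₀ᵀ * Z), ← Matrix.mul_assoc, hZ]
    _ = colNorm V₀ᵀ i := by
        refine colNorm_congr fun k => ?_
        conv_rhs => rw [← hZD]
        exact (mul_colMask_apply_of_mem (by simpa using hi) _ _).symm

theorem colMask_mul_singleton {j : Fin n} (hj : j ∈ I) :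
    colMask I * colMask {j} = colMask {j} := by
  rw [colMask, colMask, Matrix.diagonal_mul_diagonal]
  congr 1; ext i
  by_cases h : i = j
  · subst h; simp [hj]
  · simp [h]

/-- If column `j` of `C` were zero, then `X e_j = X Z e_j`. The row space of `X` contains that of
`V₀ᵀ`, so `V₀ᵀ Z e_j = V₀ᵀ e_j = 0`. Then `Z e_j = 0`, so `X e_j = 0` and `C₀ e_j = 0`,
contradicting `j ∈ I`. -/
theorem colNorm_solution_pos (h₀ : IsSVD X₀ U₀ σ₀ V₀) (hX : X = X₀ + C₀)
    (hX₀ : X₀ * colMask I = 0) (hI : I = colSupport C₀) (hsX : IsSVD X UX σX VX)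
    (hV₀ : projL VX V₀ = V₀) (hf : OracleFeasible X V₀ I Z C) {j : Fin n} (hj : j ∈ I) :
    0 < colNorm C j := by
  refine (colNorm_nonneg _ _).lt_of_ne' fun hC => ?_
  have hZ : V₀ * V₀ᵀ * Z = Z := hf.row
  have hCj : C * colMask {j} = 0 := by
    rw [← projCols_eq_mul]
    ext i k
    simp only [projCols, Finset.mem_singleton, Matrix.of_apply, Matrix.zero_apply,
      ite_eq_right_iff]
    rintro rfl
    exact colNorm_eq_zero.1 hC i
  have hXj : X * colMask {j} = X * (Z * colMask {j}) := by
    conv_lhs => rw [hf.data, Matrix.add_mul, hCj, add_zero, Matrix.mul_assoc]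
  have hVXj : VXᵀ * colMask {j} = VXᵀ * (Z * colMask {j}) := by
    rw [hsX.right_eq]
    simp only [Matrix.mul_assoc]
    rw [hXj]
  have hV : V₀ᵀ = V₀ᵀ * VX * VXᵀ := by
    conv_lhs => rw [← hV₀]
    simp only [projL, Matrix.transpose_mul, Matrix.transpose_transpose, Matrix.mul_assoc]
  have hV₀j : V₀ᵀ * (Z * colMask {j}) = 0 := by
    calc V₀ᵀ * (Z * colMask {j}) = V₀ᵀ * VX * (VXᵀ * (Z * colMask {j})) := by
          conv_lhs => rw [hV, Matrix.mul_assoc]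
      _ = V₀ᵀ * VX * VXᵀ * colMask {j} := by rw [← hVXj, ← Matrix.mul_assoc]
      _ = V₀ᵀ * colMask I * colMask {j} := by
          rw [← hV, Matrix.mul_assoc, colMask_mul_singleton hj]
      _ = 0 := by rw [right_transpose_mul_colMask h₀ hX₀, Matrix.zero_mul]
  have hZj : Z * colMask {j} = 0 := by
    rw [← hZ, Matrix.mul_assoc, Matrix.mul_assoc, hV₀j, Matrix.mul_zero]
  have hC₀j : C₀ * colMask {j} = 0 := by
    have h1 : X₀ * colMask {j} = 0 := by
      rw [← colMask_mul_singleton hj, ← Matrix.mul_assoc, hX₀, Matrix.zero_mul]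
    have h2 : C₀ = X - X₀ := by rw [hX]; abel
    rw [h2, Matrix.sub_mul, h1, hXj, hZj, Matrix.mul_zero, sub_zero]
  rw [hI, colSupport, Finset.mem_filter] at hj
  obtain ⟨i, hi⟩ := hj.2
  refine hi ?_
  rw [← mul_colMask_apply_of_mem (Finset.mem_singleton_self j) C₀ i, hC₀j, Matrix.zero_apply]

theorem IsOracleSolution.transpose_Vbar_mul_colMask (hlam : 0 < lam)
    (hsol : IsOracleSolution X V₀ I lam Z C) (h : IsSVD Z U σ V) (hU : U * Uᵀ = V₀ * V₀ᵀ)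
    (hV₀ : V₀ᵀ * V₀ = 1) (hC : ∀ j ∈ I, 0 < colNorm C j) :
    (Vbar U V V₀)ᵀ * colMask I = lam • (V₀ᵀ * (Xᵀ * colNormalize I C)) := by
  set H := colNormalize I C with hH
  -- The defect of the claimed identity serves as its own test direction: stationarity along `V₀ Δ`
  -- says that its Frobenius norm is zero.
  set Δ := (Vbar U V V₀)ᵀ * colMask I - lam • (V₀ᵀ * (Xᵀ * H)) with hΔ
  have hHI : H * colMask I = H := by rw [← projCols_eq_mul, hH, projCols_colNormalize]
  have hΔI : Δ * colMask I = Δ := by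
    rw [hΔ, Matrix.sub_mul, Matrix.smul_mul, Matrix.mul_assoc, colMask_mul_self, Matrix.mul_assoc,
      Matrix.mul_assoc, hHI]
  have hEV : V₀ * V₀ᵀ * (V₀ * Δ) = V₀ * Δ := by
    rw [Matrix.mul_assoc, ← Matrix.mul_assoc V₀ᵀ, hV₀, Matrix.one_mul]
  have h1 := hsol.trace_eq hlam h hC (E := V₀ * Δ) (by rw [hU, hEV]) hEV
    (by rw [projCols_eq_mul, Matrix.mul_assoc, hΔI])
  have h2 : ((U * Vᵀ)ᵀ * (V₀ * Δ)).trace = (((Vbar U V V₀)ᵀ * colMask I)ᵀ * Δ).trace := by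
    calc ((U * Vᵀ)ᵀ * (V₀ * Δ)).trace = (Vbar U V V₀ * Δ * colMask I).trace := by
          rw [Matrix.mul_assoc, hΔI, Vbar]
          simp only [Matrix.transpose_mul, Matrix.transpose_transpose, Matrix.mul_assoc]
      _ = _ := by
          rw [Matrix.trace_mul_comm, Matrix.transpose_mul, Matrix.transpose_transpose,
            colMask_transpose, Matrix.mul_assoc]
  have h3 : (Hᵀ * (X * (V₀ * Δ))).trace = ((V₀ᵀ * (Xᵀ * H))ᵀ * Δ).trace := by
    simp only [Matrix.transpose_mul, Matrix.transpose_transpose, Matrix.mul_assoc]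
  have h4 : (Δᵀ * Δ).trace = 0 := by
    conv_lhs => rw [hΔ, Matrix.transpose_sub, Matrix.transpose_smul, ← hΔ]
    rw [Matrix.sub_mul, Matrix.smul_mul, Matrix.trace_sub, Matrix.trace_smul, ← h2, ← h3, h1,
      smul_eq_mul, sub_self]
  rw [← Matrix.conjTranspose_eq_transpose_of_trivial,
    Matrix.trace_conjTranspose_mul_self_eq_zero_iff] at h4
  exact sub_eq_zero.1 h4

/-- The constraint gives `C = X - X Z`, whose columns lie in the column space of `X`; rescaling
columns keeps them there. -/
theorem left_proj_mul_colNormalize (hsX : IsSVD X UX σX VX) (hf : OracleFeasible X V₀ I Z C) :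
    UX * UXᵀ * colNormalize I C = colNormalize I C := by
  have h1 : C = X - X * Z := eq_sub_of_add_eq' hf.data.symm
  have h2 : UX * UXᵀ * C = C := by
    rw [h1, Matrix.mul_sub, ← Matrix.mul_assoc, hsX.left_proj]
  rw [colNormalize_eq_mul, ← Matrix.mul_assoc, h2]

/-- Such an `M` is fixed by the sandwich, that is `M (1 - S) = 0`, and `1 - S` is invertible. -/
theorem eq_zero_of_projCols_of_projR {p r : ℕ} {W : Matrix (Fin n) (Fin r) ℝ} (hW : Wᵀ * W = 1)
    (hψ : ‖gram I W‖ < 1) {M : Matrix (Fin p) (Fin n) ℝ} (hMI : projCols I M = M)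
    (hMW : projR W M = M) : M = 0 := by
  have hS := (norm_sandwichMatrix_le (I := I) hW).trans_lt hψ
  have h1 : M * (1 - sandwichMatrix I W) = 0 := by
    rw [Matrix.mul_sub, Matrix.mul_one, ← sandwich_eq, sandwich, hMW, hMI, hMW, sub_self]
  calc M = M * ((1 - sandwichMatrix I W) * neumannMatrix I W) := by
        rw [mul_neumannMatrix hS, Matrix.mul_one]
    _ = 0 := by rw [← Matrix.mul_assoc, h1, Matrix.zero_mul]

end Oracle

/-! ### The dual certificate and its estimates. -/

section Certificate

variable {d n r rX s : ℕ} {X H : Matrix (Fin d) (Fin n) ℝ} {I : Finset (Fin n)}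
  {V₀ W : Matrix (Fin n) (Fin r) ℝ}
  {UX : Matrix (Fin d) (Fin rX) ℝ} {σX : Fin rX → ℝ} {VX : Matrix (Fin n) (Fin rX) ℝ}
  {U V : Matrix (Fin n) (Fin s) ℝ} {lam : ℝ}

/-- The matrix by which `P_{Iᶜ} P_W (1 + ∑_{i ≥ 1} (P_W P_I P_W)^i) P_W` multiplies from the
right. -/
def correctionMatrix (I : Finset (Fin n)) (W : Matrix (Fin n) (Fin r) ℝ) :
    Matrix (Fin n) (Fin n) ℝ :=
  W * Wᵀ * neumannMatrix I W * (W * Wᵀ) * colMask Iᶜ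

theorem correctionMatrix_mul_colMask : correctionMatrix I W * colMask I = 0 := by
  rw [correctionMatrix, mul_assoc, colMask_compl_mul, mul_zero]

theorem correctionMatrix_mul_colMask_compl :
    correctionMatrix I W * colMask Iᶜ = correctionMatrix I W := by
  rw [correctionMatrix, mul_assoc, colMask_mul_self]

/-- This is what `Q₂` is built for: subtracting it removes the row-space component of `λ (1 - V₀
V₀ᵀ) Xᵀ H` without changing any column in `I`. -/
theorem correctionMatrix_mul_proj (hW : Wᵀ * W = 1) (hS : ‖sandwichMatrix I W‖ < 1) :
    correctionMatrix I W * (W * Wᵀ) = W * Wᵀ := by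
  calc correctionMatrix I W * (W * Wᵀ)
      = W * Wᵀ * neumannMatrix I W * sandwichMatrix Iᶜ W := by
        simp only [correctionMatrix, sandwichMatrix, mul_assoc]
    _ = neumannMatrix I W * (W * Wᵀ - sandwichMatrix I W) := by
        rw [proj_commute_neumannMatrix hW hS, sandwichMatrix_compl hW, mul_assoc, mul_sub,
          proj_mul_self hW, proj_mul_sandwichMatrix hW]
    _ = neumannMatrix I W * (1 - sandwichMatrix I W) * (W * Wᵀ) := by
        rw [mul_assoc, sub_mul, one_mul, sandwichMatrix_mul_proj hW]
    _ = W * Wᵀ := by rw [neumannMatrix_mul hS, one_mul]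

theorem norm_proj_mul_neumannMatrix_mul_le (hW : Wᵀ * W = 1) (hψ : ‖gram I W‖ < 1) :
    ‖W * Wᵀ * neumannMatrix I W * W‖ ≤ 1 / (1 - ‖gram I W‖) :=
  (l2_opNorm_mul_le_of_le_one_right (l2_opNorm_le_one_of_orth hW) _).trans
    ((l2_opNorm_mul_le_of_le_one_left (norm_proj_le hW) _).trans
      (norm_neumannMatrix_le (norm_sandwichMatrix_le hW) hψ))

theorem norm_correctionMatrix_le (hW : Wᵀ * W = 1) (hψ : ‖gram I W‖ < 1) :
    ‖correctionMatrix I W‖ ≤ 1 / (1 - ‖gram I W‖) :=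
  (l2_opNorm_mul_le_of_le_one_right (norm_colMask_le _) _).trans
    ((l2_opNorm_mul_le_of_le_one_right (norm_proj_le hW) _).trans
      ((l2_opNorm_mul_le_of_le_one_left (norm_proj_le hW) _).trans
        (norm_neumannMatrix_le (norm_sandwichMatrix_le hW) hψ)))

/-- Keeping the last factor `Wᵀ` apart turns the operator bound into a columnwise one, through which
incoherence enters. -/
theorem colNorm_correctionMatrix_le (hW : Wᵀ * W = 1) (hψ : ‖gram I W‖ < 1) {j : Fin n}
    (hj : j ∉ I) :
    colNorm (correctionMatrix I W) j ≤ 1 / (1 - ‖gram I W‖) * colNorm Wᵀ j := by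
  have h1 : colNorm (correctionMatrix I W) j =
      colNorm (W * Wᵀ * neumannMatrix I W * W * Wᵀ) j := by
    refine colNorm_congr fun i => ?_
    rw [correctionMatrix, mul_colMask_apply_of_mem (by simpa using hj)]
    simp only [Matrix.mul_assoc]
  rw [h1]
  exact (colNorm_mul_le _ _ _).trans (mul_le_mul_of_nonneg_right
    (norm_proj_mul_neumannMatrix_mul_le hW hψ) (colNorm_nonneg _ _))

theorem certQ₂_eq (hS : ‖sandwichMatrix I W‖ < 1) :
    certQ₂ X V₀ I W lam H = lam • ((1 - V₀ * V₀ᵀ) * (Xᵀ * H * correctionMatrix I W)) := by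
  have h1 : projCols Iᶜ (projR W (neumann I W (projR W (Xᵀ * H)))) =
      Xᵀ * H * correctionMatrix I W := by
    rw [neumann_eq hS, projCols_eq_mul]
    simp only [projR, correctionMatrix, Matrix.mul_assoc]
  simp only [certQ₂, h1, projL, Matrix.sub_mul, Matrix.one_mul]

theorem norm_one_sub_proj_le (hV₀ : V₀ᵀ * V₀ = 1) : ‖1 - V₀ * V₀ᵀ‖ ≤ 1 := by
  have h1 : (1 - V₀ * V₀ᵀ)ᵀ * (1 - V₀ * V₀ᵀ) = 1 - V₀ * V₀ᵀ := by
    rw [Matrix.transpose_sub, Matrix.transpose_one, Matrix.transpose_mul,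
      Matrix.transpose_transpose, mul_sub, mul_one, sub_mul, one_mul, proj_mul_self hV₀]
    abel
  have h2 := l2_opNorm_transpose_mul_self (1 - V₀ * V₀ᵀ)
  rw [h1] at h2
  nlinarith [norm_nonneg (1 - V₀ * V₀ᵀ)]

theorem one_sub_proj_mul (hV₀ : V₀ᵀ * V₀ = 1) : V₀ * V₀ᵀ * (1 - V₀ * V₀ᵀ) = 0 := by
  rw [mul_sub, mul_one, proj_mul_self hV₀, sub_self]

theorem certQ_eq (hS : ‖sandwichMatrix I W‖ < 1) :
    certQ X UX σX VX V₀ I W lam H = UX * Matrix.diagonal σX⁻¹ * VXᵀ *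
      (V₀ * Wᵀ + lam • ((1 - V₀ * V₀ᵀ) * (Xᵀ * H - Xᵀ * H * correctionMatrix I W))) := by
  rw [certQ, certQ₁, certQ₂_eq hS, projL]
  congr 1
  rw [Matrix.mul_sub, Matrix.sub_mul 1 _ (Xᵀ * H), Matrix.one_mul, smul_sub, smul_sub]
  abel

theorem transpose_mul_certQ (hsX : IsSVD X UX σX VX) (hV₀X : VX * VXᵀ * V₀ = V₀)
    (hS : ‖sandwichMatrix I W‖ < 1) :
    Xᵀ * certQ X UX σX VX V₀ I W lam H =
      V₀ * Wᵀ + lam • ((1 - V₀ * V₀ᵀ) * (Xᵀ * H - Xᵀ * H * correctionMatrix I W)) := by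
  rw [certQ_eq hS, ← Matrix.mul_assoc, hsX.transpose_mul_pinv]
  simp only [Matrix.mul_add, Matrix.sub_mul, Matrix.mul_sub, Matrix.mul_smul, Matrix.one_mul,
    ← Matrix.mul_assoc, hV₀X, hsX.right_proj]

theorem projT_transpose_mul_certQ (hsX : IsSVD X UX σX VX) (hV₀ : V₀ᵀ * V₀ = 1)
    (hV₀X : VX * VXᵀ * V₀ = V₀) (hW : Wᵀ * W = 1) (hS : ‖sandwichMatrix I W‖ < 1)
    (hU : U * Uᵀ = V₀ * V₀ᵀ) (hV : W * Wᵀ = V * Vᵀ) :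
    projT U V (Xᵀ * certQ X UX σX VX V₀ I W lam H) = V₀ * Wᵀ := by
  have h1 : V₀ * V₀ᵀ * (V₀ * Wᵀ) = V₀ * Wᵀ := by
    rw [Matrix.mul_assoc, ← Matrix.mul_assoc V₀ᵀ, hV₀, Matrix.one_mul]
  have h2 : V₀ * Wᵀ * (W * Wᵀ) = V₀ * Wᵀ := by
    rw [Matrix.mul_assoc, ← Matrix.mul_assoc Wᵀ, hW, Matrix.one_mul]
  have h3 : (Xᵀ * H - Xᵀ * H * correctionMatrix I W) * (W * Wᵀ) = 0 := by
    rw [Matrix.sub_mul, Matrix.mul_assoc (Xᵀ * H), correctionMatrix_mul_proj hW hS, sub_self]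
  rw [transpose_mul_certQ hsX hV₀X hS, projT, projL, projR, projL, hU, ← hV, Matrix.add_mul,
    Matrix.smul_mul, Matrix.mul_assoc (1 - V₀ * V₀ᵀ), h3, h2, Matrix.mul_zero, smul_zero, add_zero,
    Matrix.mul_add, h1, Matrix.mul_smul, ← Matrix.mul_assoc (V₀ * V₀ᵀ), one_sub_proj_mul hV₀,
    Matrix.zero_mul, smul_zero]
  abel

theorem norm_certQ_residual_le (hsX : IsSVD X UX σX VX) (hV₀ : V₀ᵀ * V₀ = 1)
    (hV₀X : VX * VXᵀ * V₀ = V₀) (hW : Wᵀ * W = 1) (hψ : ‖gram I W‖ < 1)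
    (hU : U * Uᵀ = V₀ * V₀ᵀ) (hV : W * Wᵀ = V * Vᵀ) (hlam : 0 ≤ lam) :
    ‖Xᵀ * certQ X UX σX VX V₀ I W lam H - projT U V (Xᵀ * certQ X UX σX VX V₀ I W lam H)‖ ≤
      lam * (‖X‖ * ‖H‖ * (1 + 1 / (1 - ‖gram I W‖))) := by
  have hS := (norm_sandwichMatrix_le (I := I) hW).trans_lt hψ
  have hB : ‖Xᵀ * H‖ ≤ ‖X‖ * ‖H‖ :=
    (Matrix.l2_opNorm_mul _ _).trans_eq (by rw [l2_opNorm_transpose])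
  rw [projT_transpose_mul_certQ hsX hV₀ hV₀X hW hS hU hV, transpose_mul_certQ hsX hV₀X hS,
    add_sub_cancel_left, norm_smul, Real.norm_of_nonneg hlam]
  refine mul_le_mul_of_nonneg_left ?_ hlam
  refine (l2_opNorm_mul_le_of_le_one_left (norm_one_sub_proj_le hV₀) _).trans ?_
  refine (norm_sub_le _ _).trans ?_
  rw [mul_add, mul_one]
  exact add_le_add hB ((Matrix.l2_opNorm_mul _ _).trans
    (mul_le_mul hB (norm_correctionMatrix_le hW hψ) (norm_nonneg _) (by positivity)))

theorem certQ_mul_colMask (hsX : IsSVD X UX σX VX) (hS : ‖sandwichMatrix I W‖ < 1)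
    (hH : H * colMask I = H) (hUH : UX * UXᵀ * H = H)
    (hWI : Wᵀ * colMask I = lam • (V₀ᵀ * (Xᵀ * H))) :
    certQ X UX σX VX V₀ I W lam H * colMask I = lam • H := by
  have h1 : (V₀ * Wᵀ + lam • ((1 - V₀ * V₀ᵀ) * (Xᵀ * H - Xᵀ * H * correctionMatrix I W))) *
      colMask I = lam • (Xᵀ * H) := by
    rw [Matrix.add_mul, Matrix.mul_assoc, hWI, Matrix.smul_mul, Matrix.mul_assoc (1 - V₀ * V₀ᵀ),
      Matrix.sub_mul (Xᵀ * H), Matrix.mul_assoc Xᵀ H (colMask I), hH, Matrix.mul_assoc (Xᵀ * H),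
      correctionMatrix_mul_colMask, Matrix.mul_zero, sub_zero, Matrix.sub_mul, Matrix.one_mul,
      Matrix.mul_smul, smul_sub, Matrix.mul_assoc V₀]
    abel
  rw [certQ_eq hS, Matrix.mul_assoc, h1, Matrix.mul_smul, ← Matrix.mul_assoc,
    hsX.pinv_mul_transpose, hUH]

/-- As `H` vanishes off `I`, only the `V₀ Wᵀ` term and the correction survive. The pseudoinverse
sends `Xᵀ H` back to `H`, so the remaining factor is `Σ_X⁻¹ V_Xᵀ V₀`, the quantity controlled by
relative well-definedness. -/
theorem certQ_mul_colMask_compl (hsX : IsSVD X UX σX VX) (hS : ‖sandwichMatrix I W‖ < 1)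
    (hH : H * colMask I = H) (hUH : UX * UXᵀ * H = H) :
    certQ X UX σX VX V₀ I W lam H * colMask Iᶜ =
      UX * (Matrix.diagonal σX⁻¹ * VXᵀ * V₀) * (Wᵀ * colMask Iᶜ) -
        lam • ((H - UX * (Matrix.diagonal σX⁻¹ * VXᵀ * V₀) * (V₀ᵀ * (Xᵀ * H))) *
          correctionMatrix I W) := by
  have hHc : H * colMask Iᶜ = 0 := by
    rw [← hH, Matrix.mul_assoc, colMask_mul_compl, Matrix.mul_zero]
  have h1 : (V₀ * Wᵀ + lam • ((1 - V₀ * V₀ᵀ) * (Xᵀ * H - Xᵀ * H * correctionMatrix I W))) *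
      colMask Iᶜ = V₀ * (Wᵀ * colMask Iᶜ) - lam • (Xᵀ * H * correctionMatrix I W -
        V₀ * (V₀ᵀ * (Xᵀ * H)) * correctionMatrix I W) := by
    rw [Matrix.add_mul, Matrix.mul_assoc, Matrix.smul_mul, Matrix.mul_assoc (1 - V₀ * V₀ᵀ),
      Matrix.sub_mul (Xᵀ * H), Matrix.mul_assoc Xᵀ H (colMask Iᶜ), hHc, Matrix.mul_zero,
      Matrix.mul_assoc (Xᵀ * H), correctionMatrix_mul_colMask_compl, zero_sub, Matrix.mul_neg,
      Matrix.sub_mul, Matrix.one_mul, smul_neg, ← sub_eq_add_neg]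
    simp only [Matrix.mul_assoc]
  rw [certQ_eq hS, Matrix.mul_assoc, h1, Matrix.mul_sub, Matrix.mul_smul, Matrix.mul_sub,
    ← Matrix.mul_assoc _ (Xᵀ * H), ← Matrix.mul_assoc _ Xᵀ, hsX.pinv_mul_transpose, hUH]
  simp only [Matrix.mul_assoc, Matrix.sub_mul]

theorem colNorm_certQ_le (hsX : IsSVD X UX σX VX) (hV₀ : V₀ᵀ * V₀ = 1) (hW : Wᵀ * W = 1)
    (hψ : ‖gram I W‖ < 1) (hH : H * colMask I = H) (hUH : UX * UXᵀ * H = H) (hlam : 0 ≤ lam)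
    {κ : ℝ} (hκ : ‖Matrix.diagonal σX⁻¹ * VXᵀ * V₀‖ ≤ κ) {j : Fin n} (hj : j ∉ I) :
    colNorm (certQ X UX σX VX V₀ I W lam H * colMask Iᶜ) j ≤
      (κ + lam * (‖H‖ * (1 + κ * ‖X‖) * (1 / (1 - ‖gram I W‖)))) * colNorm Wᵀ j := by
  have hS := (norm_sandwichMatrix_le (I := I) hW).trans_lt hψ
  have hκ0 : 0 ≤ κ := (norm_nonneg _).trans hκ
  have h1 : ‖UX * (Matrix.diagonal σX⁻¹ * VXᵀ * V₀)‖ ≤ κ :=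
    (l2_opNorm_mul_le_of_le_one_left (l2_opNorm_le_one_of_orth hsX.orthU) _).trans hκ
  have h2 : ‖V₀ᵀ * (Xᵀ * H)‖ ≤ ‖X‖ * ‖H‖ :=
    (l2_opNorm_mul_le_of_le_one_left
      ((l2_opNorm_transpose V₀).trans_le (l2_opNorm_le_one_of_orth hV₀)) _).trans
      ((Matrix.l2_opNorm_mul _ _).trans_eq (by rw [l2_opNorm_transpose]))
  have h3 : ‖H - UX * (Matrix.diagonal σX⁻¹ * VXᵀ * V₀) * (V₀ᵀ * (Xᵀ * H))‖ ≤
      ‖H‖ * (1 + κ * ‖X‖) := by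
    refine (norm_sub_le _ _).trans ?_
    have := (Matrix.l2_opNorm_mul (UX * (Matrix.diagonal σX⁻¹ * VXᵀ * V₀))
      (V₀ᵀ * (Xᵀ * H))).trans (mul_le_mul h1 h2 (norm_nonneg _) hκ0)
    linarith
  have h4 : colNorm (Wᵀ * colMask Iᶜ) j = colNorm Wᵀ j :=
    colNorm_congr fun i => mul_colMask_apply_of_mem (by simpa using hj) _ _
  rw [certQ_mul_colMask_compl hsX hS hH hUH, add_mul]
  refine (colNorm_sub_le _ _ _).trans (add_le_add ?_ ?_)
  · refine (colNorm_mul_le _ _ _).trans ?_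
    rw [h4]
    exact mul_le_mul_of_nonneg_right h1 (colNorm_nonneg _ _)
  · rw [colNorm_smul, abs_of_nonneg hlam, mul_assoc lam, mul_assoc (‖H‖ * _)]
    exact mul_le_mul_of_nonneg_left ((colNorm_mul_le _ _ _).trans
      (mul_le_mul h3 (colNorm_correctionMatrix_le hW hψ hj) (colNorm_nonneg _ _)
        (by positivity))) hlam

end Certificate

/-! ### Scalar inequalities behind the bounds on `γ` and `λ`. -/

theorem norm2Inf_lt {p q : ℕ} {M : Matrix (Fin p) (Fin q) ℝ} {c : ℝ} (hc : 0 < c)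
    (h : ∀ j, colNorm M j < c) : norm2Inf M < c := by
  rw [norm2Inf]
  rcases isEmpty_or_nonempty (Fin q) with hq | hq
  -- With no columns the supremum takes its default value 0, hence the hypothesis `0 < c`.
  · rwa [Real.iSup_of_isEmpty]
  · obtain ⟨j, hj⟩ := exists_eq_ciSup_of_finite (f := fun j => colNorm M j)
    rw [← hj]
    exact h j

theorem margin_pos_of_lt {a ψ β m : ℝ} (ha : 0 ≤ a) (hψ : ψ < 1) (hβ : 0 < β)
    (h : a < β ^ 2 * (1 - ψ) ^ 2 / ((3 - ψ + β) ^ 2 * m)) :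
    0 < β * (1 - ψ) - (1 + β) * √(a * m) := by
  have hD : 0 < 3 - ψ + β := by linarith
  have hm : 0 < m := by
    by_contra hm
    have : β ^ 2 * (1 - ψ) ^ 2 / ((3 - ψ + β) ^ 2 * m) ≤ 0 :=
      div_nonpos_of_nonneg_of_nonpos (by positivity)
        (mul_nonpos_of_nonneg_of_nonpos (by positivity) (not_lt.1 hm))
    linarith
  have h1 : a * m < (β * (1 - ψ) / (3 - ψ + β)) ^ 2 := by
    rw [lt_div_iff₀ (by positivity)] at h
    rw [div_pow, lt_div_iff₀ (by positivity)]
    linarith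
  have hb : 0 < β * (1 - ψ) := mul_pos hβ (by linarith)
  have h2 : √(a * m) < β * (1 - ψ) / (3 - ψ + β) := (Real.sqrt_lt' (by positivity)).2 h1
  -- Since `ψ < 1`, the constant `3 - ψ + β` exceeds the `1 + β` required here.
  have h3 : (1 + β) * √(a * m) ≤ (3 - ψ + β) * √(a * m) :=
    mul_le_mul_of_nonneg_right (by linarith) (Real.sqrt_nonneg _)
  rw [lt_div_iff₀ hD] at h2
  linarith

/-- Here `c` bounds a column of `V̄ᵀ`, `h` bounds `‖Ĥ‖`, and `t = h c`. Solving the inequality for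
`lam` produces exactly the stated lower bound. -/
theorem column_bound_lt {ψ β x N lam s t c h : ℝ} (hψ : ψ < 1) (hβ : 0 < β) (hx : 0 < x)
    (hN : 0 < N) (hden : 0 < β * (1 - ψ) - (1 + β) * t) (hc : c = s / N) (hch : h * c = t)
    (hlow : (1 - ψ) * s / (x * N * (β * (1 - ψ) - (1 + β) * t)) < lam) :
    (1 / (β * x) + lam * (h * (1 + 1 / (β * x) * x) * (1 / (1 - ψ)))) * c < lam := by
  have hψ' : 0 < 1 - ψ := by linarith
  rw [div_lt_iff₀ (by positivity)] at hlow
  have h1 : (1 / (β * x) + lam * (h * (1 + 1 / (β * x) * x) * (1 / (1 - ψ)))) * c =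
      s / (N * (β * x)) + lam * (t * (1 + β) / (β * (1 - ψ))) := by
    rw [← hch, hc]; field_simp; ring
  rw [h1, ← sub_pos]
  have h2 : lam - (s / (N * (β * x)) + lam * (t * (1 + β) / (β * (1 - ψ)))) =
      (lam * (x * N * (β * (1 - ψ) - (1 + β) * t)) - (1 - ψ) * s) / (N * x * β * (1 - ψ)) := by
    field_simp; ring
  rw [h2]
  exact div_pos (by linarith) (by positivity)

end LRR

end

/-! ### Assembly of the certificate. -/

theorem theorem4 {d n r₀ rX rZ : ℕ}
    -- the data `X = X₀ + C₀`; the outliers occupy the columns in `I₀`, where `X₀` vanishes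
    (X X₀ C₀ : Matrix (Fin d) (Fin n) ℝ) (hX : X = X₀ + C₀) (hX₀ : X₀ ≠ 0)
    (I₀ : Finset (Fin n)) (hI₀ : I₀ = LRR.colSupport C₀) (hX₀I₀ : LRR.projCols I₀ X₀ = 0)
    (γ : ℝ) (hγ : γ = (I₀.card : ℝ) / n)
    -- singular value decompositions of `X₀` and `X`
    (U₀ : Matrix (Fin d) (Fin r₀) ℝ) (σ₀ : Fin r₀ → ℝ) (V₀ : Matrix (Fin n) (Fin r₀) ℝ)
    (hsvd₀ : LRR.IsSVD X₀ U₀ σ₀ V₀)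
    (UX : Matrix (Fin d) (Fin rX) ℝ) (σX : Fin rX → ℝ) (VX : Matrix (Fin n) (Fin rX) ℝ)
    (hsvdX : LRR.IsSVD X UX σX VX)
    -- standing assumptions: `V₀ ∈ P_{V_X}^L`, relative well-definedness, incoherence
    (hV₀ : LRR.projL VX V₀ = V₀)
    (β : ℝ) (hβ : 0 < β) (hRWD : LRR.IsRWD X σX VX V₀ β)
    (μ : ℝ) (hμ : LRR.IsColIncoherent V₀ γ μ)
    -- a solution of the oracle problem
    (lam : ℝ) (hlam : 0 < lam)
    (Zh : Matrix (Fin n) (Fin n) ℝ) (Ch : Matrix (Fin d) (Fin n) ℝ)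
    (hsol : LRR.IsOracleSolution X V₀ I₀ lam Zh Ch)
    (Uh : Matrix (Fin n) (Fin rZ) ℝ) (σh : Fin rZ → ℝ) (Vh : Matrix (Fin n) (Fin rZ) ℝ)
    (hsvdZ : LRR.IsSVD Zh Uh σh Vh)
    (Vb : Matrix (Fin n) (Fin r₀) ℝ) (hVb : Vb = LRR.Vbar Uh Vh V₀)
    (Hh : Matrix (Fin d) (Fin n) ℝ) (hHh : Hh = LRR.colNormalize I₀ Ch)
    (ψ : ℝ) (hψ : ψ = ‖LRR.gram I₀ Vb‖) (hψ1 : ψ < 1)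
    -- the bounds on `γ` and on `lam` (the upper bound on `lam` is void when `γ = 0`)
    (hγb : γ / (1 - γ) < β ^ 2 * (1 - ψ) ^ 2 / ((3 - ψ + β) ^ 2 * (μ * r₀)))
    (hlow : (1 - ψ) * √(μ * r₀ / (1 - γ)) /
        (‖X‖ * √n * (β * (1 - ψ) - (1 + β) * √(γ / (1 - γ) * (μ * r₀)))) < lam)
    (hupp : 0 < γ → lam < (1 - ψ) / (‖X‖ * √(γ * n) * (2 - ψ))) :
    -- the Neumann series converges, and inverts `P_V̄ P_{I₀ᶜ} P_V̄` on the range of `P_V̄`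
    ((∀ M : Matrix (Fin n) (Fin n) ℝ, Summable fun i : ℕ => (LRR.sandwich I₀ Vb)^[i + 1] M) ∧
      Set.InvOn (LRR.neumann I₀ Vb) (LRR.sandwich I₀ᶜ Vb)
        {M : Matrix (Fin n) (Fin n) ℝ | LRR.projR Vb M = M} {M | LRR.projR Vb M = M}) ∧
    -- `Q` satisfies the four dual conditions for `(Zh, Ch)`
    LRR.DualConditions X I₀ lam Uh Vh Ch (LRR.certQ X UX σX VX V₀ I₀ Vb lam Hh) ∧
    -- the ranges of `P_{I₀}` and `P_V̂` meet only in `0`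
    (∀ M : Matrix (Fin n) (Fin n) ℝ, LRR.projCols I₀ M = M → LRR.projR Vh M = M → M = 0) := by
  have hX₀D : X₀ * LRR.colMask I₀ = 0 := by rw [← LRR.projCols_eq_mul, hX₀I₀]
  have hC₀D : C₀ * LRR.colMask I₀ = C₀ := by
    rw [← LRR.projCols_eq_mul, hI₀, LRR.projCols_colSupport]
  have hV₀V₀ := hsvd₀.orthV
  have hZ : V₀ * V₀ᵀ * Zh = Zh := hsol.feasible.row
  have hZD := LRR.right_transpose_mul_solution hsvd₀ hX hX₀D hC₀D hsol.feasible
  have hU := LRR.left_proj_eq hZD hZ hsvdZ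
  have hCpos : ∀ j ∈ I₀, 0 < LRR.colNorm Ch j := fun j hj =>
    LRR.colNorm_solution_pos hsvd₀ hX hX₀D hI₀ hsvdX hV₀ hsol.feasible hj
  have hW : Vbᵀ * Vb = 1 := hVb ▸ LRR.Vbar_orth hsvdZ hU hV₀V₀
  have hWV : Vb * Vbᵀ = Vh * Vhᵀ := hVb ▸ LRR.Vbar_mul_transpose hsvdZ hU
  have hWU : V₀ * Vbᵀ = Uh * Vhᵀ := hVb ▸ LRR.mul_transpose_Vbar hsvdZ hU
  have hWI : Vbᵀ * LRR.colMask I₀ = lam • (V₀ᵀ * (Xᵀ * Hh)) := by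
    rw [hVb, hHh]
    exact hsol.transpose_Vbar_mul_colMask hlam hsvdZ hU hV₀V₀ hCpos
  have hHD : Hh * LRR.colMask I₀ = Hh := by
    rw [← LRR.projCols_eq_mul, hHh, LRR.projCols_colNormalize]
  have hUH : UX * UXᵀ * Hh = Hh :=
    hHh ▸ LRR.left_proj_mul_colNormalize hsvdX hsol.feasible
  have hG : ‖LRR.gram I₀ Vb‖ < 1 := hψ ▸ hψ1
  have hS := (LRR.norm_sandwichMatrix_le (I := I₀) hW).trans_lt hG
  have hψ0 : 0 ≤ ψ := hψ ▸ norm_nonneg _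
  have hn : 0 < n := by
    rcases Nat.eq_zero_or_pos n with rfl | h
    · exact absurd (Subsingleton.elim X₀ 0) hX₀
    · exact h
  have hn' : (0 : ℝ) < n := Nat.cast_pos.2 hn
  have hXpos : 0 < ‖X‖ := by
    refine norm_pos_iff.2 fun h => hX₀ ?_
    rw [← LRR.mul_colMask_compl_eq hX hX₀D hC₀D, h, Matrix.zero_mul]
  have hγn : γ * n = I₀.card := by rw [hγ, div_mul_cancel₀ _ hn'.ne']
  have hγ0 : 0 ≤ γ := by rw [hγ]; positivity
  have hγ1 : γ ≤ 1 := by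
    rw [hγ, div_le_one hn']
    exact_mod_cast (Finset.card_le_univ I₀).trans_eq (Fintype.card_fin n)
  have hHnorm : ‖Hh‖ ≤ √(γ * n) := by rw [hγn, hHh]; exact LRR.norm_colNormalize_le _ _
  have hden := LRR.margin_pos_of_lt (div_nonneg hγ0 (by linarith)) hψ1 hβ hγb
  refine ⟨⟨fun M => (LRR.hasSum_sandwich_iterate hS M).summable,
    LRR.invOn_neumann_sandwich hW hS⟩, ⟨?_, ?_, ?_, ?_⟩, fun M hMI hMV => ?_⟩
  · rw [LRR.projT_transpose_mul_certQ hsvdX hV₀V₀ hV₀ hW hS hU hWV, hWU]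
  · refine (LRR.norm_certQ_residual_le hsvdX hV₀V₀ hV₀ hW hG hU hWV hlam.le).trans_lt ?_
    rw [← hψ]
    have hψ' : 0 < 1 - ψ := by linarith
    have h1 : lam * (‖X‖ * ‖Hh‖ * (1 + 1 / (1 - ψ))) ≤
        lam * (‖X‖ * √(γ * n) * (1 + 1 / (1 - ψ))) := by gcongr
    refine h1.trans_lt ?_
    rcases hγ0.eq_or_lt with h0 | h0
    -- Without outliers `√(γ n) = 0`, so the bound is `0 < 1` for every `lam`.
    · simp [← h0]
    · have h2 := hupp h0
      have h3 : 0 < √(γ * n) := Real.sqrt_pos.2 (mul_pos h0 hn')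
      have h4 : 0 < 2 - ψ := by linarith
      rw [lt_div_iff₀ (by positivity)] at h2
      -- The factor `2 - ψ` in the upper bound on `lam` comes from `1 + 1 / (1 - ψ) = (2 - ψ) / (1 -
      -- ψ)`.
      have h5 : lam * (‖X‖ * √(γ * n) * (1 + 1 / (1 - ψ))) =
          lam * (‖X‖ * √(γ * n) * (2 - ψ)) / (1 - ψ) := by
        field_simp; ring
      rw [h5, div_lt_one hψ']
      exact h2
  · rw [LRR.projCols_eq_mul, LRR.certQ_mul_colMask hsvdX hS hHD hUH hWI, hHh]
  · refine LRR.norm2Inf_lt hlam fun j => ?_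
    rw [LRR.projCols_eq_mul]
    by_cases hj : j ∈ I₀
    · rw [LRR.colNorm_eq_zero.2 fun i => ?_]
      · exact hlam
      · rw [← LRR.projCols_eq_mul]; simp [LRR.projCols, hj]
    · have hcol : LRR.colNorm Vbᵀ j ≤ √(μ * r₀ / (1 - γ)) / √n := by
        rw [hVb, ← Real.sqrt_div' _ hn'.le, div_div]
        exact (LRR.colNorm_Vbar_le hV₀V₀ hZD hZ hsvdZ hj).trans (Real.le_sqrt_of_sq_le (hμ j))
      refine (LRR.colNorm_certQ_le hsvdX hV₀V₀ hW hG hHD hUH hlam.le hRWD hj).trans_lt ?_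
      rw [← hψ]
      have hψ' : 0 < 1 - ψ := by linarith
      refine lt_of_le_of_lt ?_ (LRR.column_bound_lt (h := √(γ * n)) hψ1 hβ hXpos
        (Real.sqrt_pos.2 hn') hden rfl ?_ hlow)
      · have := LRR.colNorm_nonneg Vbᵀ j
        gcongr
      -- The `√n` in `‖Ĥ‖ ≤ √(γ n)` cancels the `1 / √n` of incoherence, leaving `√(γ / (1 - γ) * (μ
      -- r₀))`.
      · rw [Real.sqrt_mul hγ0, mul_assoc, mul_div_cancel₀ _ (Real.sqrt_pos.2 hn').ne',
          ← Real.sqrt_mul hγ0]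
        congr 1; ring
  · refine LRR.eq_zero_of_projCols_of_projR hW hG hMI ?_
    rw [LRR.projR] at hMV ⊢
    rwa [hWV]
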